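/- Let $\mathbb{R}^3_1$ be $\mathbb{R}^3$ with the Lorentzian metric $\langle\,,\rangle=dx_1^2+dx_2^2-dx_3^2$, and let $\pi_0:\mathbb{R}^3\to\{x_3=0\}\equiv\mathbb{C}$ be the orthogonal projection. Let $\mathcal{M}$ be a connected Riemann surface with boundary: a closed connected subset of a Riemann surface $\mathcal{M}'$ without boundary, together with a set $\partial\mathcal{M}\subset\mathcal{M}$ which contains the topological frontier of $\mathcal{M}$ in $\mathcal{M}'$ and is the union of a locally finite family of pairwise disjoint sets, each being a piecewise $\mathcal{C}^1$ simple loop or properly embedded line contained in the frontier, or a single point; the interior $\mathrm{Int}(\mathcal{M})=\mathcal{M}\setminus\partial\mathcal{M}$ is dense in $\mathcal{M}$. Assume $\partial\mathcal{M}\neq\emptyset$. Let $X:\mathcal{M}\to\mathbb{R}^3_1$ be a proper conformal maximal immersion, that is, a proper map which is the restriction of a smooth map $\mathcal{M}'\to\mathbb{R}^3_1$ and which on $\mathrm{Int}(\mathcal{M})$ is spacelike (the induced metric is Riemannian), conformal and of zero mean curvature; points of $\partial\mathcal{M}$ are allowed to be singular. Suppose that $X(\mathcal{M})$ is the graph $\{(z,u(z))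 : z\in\Omega\}$ of a real function $u$ on a closed set $\Omega\subset\{x_3=0\}\equiv\mathbb{C}$ which is starlike with respect to $\pi_0(X(p_0))$ for some $p_0\in\mathrm{Int}(\mathcal{M})$. Then $\mathcal{M}$ is relative parabolic: every bounded continuous function on $\mathcal{M}$ that is harmonic on $\mathrm{Int}(\mathcal{M})$ and vanishes on $\partial\mathcal{M}$ is identically zero. -/

import Mathlib

open scoped Manifold ContDiff

namespace MaximalSurface

/-- The vector space underlying the Lorentz-Minkowski space `ℝ³₁`. -/
abbrev E3 : Type := EuclideanSpace ℝ (Fin 3)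

/-- The Lorentzian metric `dx₁² + dx₂² - dx₃²`. -/
def lorentz (x y : E3) : ℝ := x 0 * y 0 + x 1 * y 1 - x 2 * y 2

/-- The orthogonal projection onto the plane `{x₃ = 0}`, which is identified with `ℂ`. -/
def proj₀ (x : E3) : ℂ := ⟨x 0, x 1⟩

section Curves

variable {R : Type*} [TopologicalSpace R] [ChartedSpace ℂ R]

/-- A piecewise `C¹` curve: near every parameter `t` it is `C¹` on some `[t - ε, t]` and on
`[t, t + ε]`. (So it is continuous, and every compact interval splits into finitely many closed
intervals on which the curve is `C¹`.) -/
def PiecewiseC1 (c : ℝ → R) : Prop :=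
  ∀ t : ℝ, ∃ ε > 0,
    ContMDiffOn 𝓘(ℝ, ℝ) 𝓘(ℝ, ℂ) 1 c (Set.Icc (t - ε) t) ∧
    ContMDiffOn 𝓘(ℝ, ℝ) 𝓘(ℝ, ℂ) 1 c (Set.Icc t (t + ε))

/-- The trace of a piecewise `C¹` simple loop. -/
def IsSimpleLoop (Γ : Set R) : Prop :=
  ∃ c : ℝ → R, PiecewiseC1 c ∧ Function.Periodic c 1 ∧ Set.InjOn c (Set.Ico 0 1) ∧ Set.range c = Γ

/-- The trace of a properly embedded piecewise `C¹` line. -/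
def IsProperLine (Γ : Set R) : Prop :=
  ∃ c : ℝ → R, PiecewiseC1 c ∧ Topology.IsClosedEmbedding c ∧ Set.range c = Γ

end Curves

/-- A connected Riemann surface with (possibly empty) boundary, sitting as a closed subset
`carrier` in a Riemann surface `R` without boundary. The boundary is a locally finite union of
pairwise disjoint members, each of which is a piecewise `C¹` simple loop or properly embedded line
in the topological frontier, or a single point. It contains the whole frontier; a
single-point member may be a point around which `carrier` is a full neighbourhood. -/
structure BorderedSurface (R : Type*) [TopologicalSpace R] [ChartedSpace ℂ R] where
  carrier : Set R
  boundary : Set R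
  isClosed : IsClosed carrier
  isConnected : IsConnected carrier
  boundary_subset : boundary ⊆ carrier
  frontier_subset : frontier carrier ⊆ boundary
  interior_dense : carrier ⊆ closure (carrier \ boundary)
  boundary_curves : ∃ 𝒞 : Set (Set R), 𝒞.PairwiseDisjoint id ∧
    LocallyFinite (fun Γ : 𝒞 => (Γ : Set R)) ∧ ⋃₀ 𝒞 = boundary ∧
    ∀ Γ ∈ 𝒞, (∃ p, Γ = {p}) ∨ ((IsSimpleLoop Γ ∨ IsProperLine Γ) ∧ Γ ⊆ frontier carrier)

section Surfaces

variable {R : Type*} [TopologicalSpace R] [ChartedSpace ℂ R]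

/-- `Int(M) = M - ∂M`. -/
def BorderedSurface.int (M : BorderedSurface R) : Set R := M.carrier \ M.boundary

/-- `f` is harmonic on `U`: it is so in every local holomorphic coordinate. -/
def HarmonicOnSurface (f : R → ℝ) (U : Set R) : Prop :=
  ∀ e ∈ atlas ℂ R,
    InnerProductSpace.HarmonicOnNhd (f ∘ e.symm) (e.target ∩ e.symm ⁻¹' U)

/-- Relative parabolicity: a bounded function that is continuous on `M`, harmonic on `Int(M)` and
zero on `∂M` vanishes identically on `M`. -/
def BorderedSurface.RelativeParabolic (M : BorderedSurface R) : Prop :=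
  ∀ f : R → ℝ, ContinuousOn f M.carrier → HarmonicOnSurface f M.int →
    (∃ C : ℝ, ∀ p ∈ M.carrier, |f p| ≤ C) → (∀ p ∈ M.boundary, f p = 0) →
    ∀ p ∈ M.carrier, f p = 0

end Surfaces

section Parametrized

/-! Local geometry of a parametrized surface `Y(u + i v)` in `ℝ³₁`. -/

/-- The first derivative of `Y` in the direction `a`; `Y_u` is `a = 1`, `Y_v` is `a = i`. -/
noncomputable def D (Y : ℂ → E3) (a : ℂ) (z : ℂ) : E3 := fderiv ℝ Y z a

/-- The induced metric on the parameter domain. -/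
noncomputable def firstForm (Y : ℂ → E3) (z a b : ℂ) : ℝ := lorentz (D Y a z) (D Y b z)

/-- The second fundamental form with respect to the normal vector `N`. -/
noncomputable def secondForm (Y : ℂ → E3) (N : E3) (z a b : ℂ) : ℝ :=
  lorentz (D (D Y b) a z) N

/-- The induced metric is Riemannian at `z`. -/
def SpacelikeAt (Y : ℂ → E3) (z : ℂ) : Prop := ∀ a : ℂ, a ≠ 0 → 0 < firstForm Y z a a

/-- The induced metric at `z` is a multiple of `du² + dv²`. -/
def IsothermalAt (Y : ℂ → E3) (z : ℂ) : Prop :=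
  firstForm Y z 1 1 = firstForm Y z Complex.I Complex.I ∧ firstForm Y z 1 Complex.I = 0

/-- `N` is a unit (timelike) normal of `Y` at `z`. -/
def IsUnitNormal (Y : ℂ → E3) (z : ℂ) (N : E3) : Prop :=
  lorentz N N = -1 ∧ ∀ a : ℂ, lorentz (D Y a z) N = 0

/-- The mean curvature with respect to `N`: half the trace of the second fundamental form with
respect to the first one. -/
noncomputable def meanCurvature (Y : ℂ → E3) (N : E3) (z : ℂ) : ℝ :=
  (secondForm Y N z 1 1 * firstForm Y z Complex.I Complex.I
      - 2 * secondForm Y N z 1 Complex.I * firstForm Y z 1 Complex.I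
      + secondForm Y N z Complex.I Complex.I * firstForm Y z 1 1) /
    (2 * (firstForm Y z 1 1 * firstForm Y z Complex.I Complex.I - firstForm Y z 1 Complex.I ^ 2))

end Parametrized

/-- A conformal maximal immersion of the bordered surface `M`: the restriction to `M` of a smooth
map of the ambient surface, which on `Int(M)` is spacelike, conformal and of zero mean curvature.
Nothing is required of the induced metric at boundary points. -/
structure IsConformalMaximalImmersion {R : Type*} [TopologicalSpace R] [ChartedSpace ℂ R]
    (M : BorderedSurface R) (X : R → E3) : Prop where
  smooth : ContMDiff 𝓘(ℝ, ℂ) 𝓘(ℝ, E3) ∞ X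
  spacelike : ∀ e ∈ atlas ℂ R, ∀ z ∈ e.target, e.symm z ∈ M.int → SpacelikeAt (X ∘ e.symm) z
  conformal : ∀ e ∈ atlas ℂ R, ∀ z ∈ e.target, e.symm z ∈ M.int → IsothermalAt (X ∘ e.symm) z
  maximal : ∀ e ∈ atlas ℂ R, ∀ z ∈ e.target, e.symm z ∈ M.int →
    ∀ N : E3, IsUnitNormal (X ∘ e.symm) z N → meanCurvature (X ∘ e.symm) N z = 0

/-- `S ⊆ ℝ³₁` is the graph of a real function on `Ω ⊆ {x₃ = 0}`. -/
def IsGraphOver (S : Set E3) (Ω : Set ℂ) : Prop :=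
  ∃ u : ℂ → ℝ, S = {x : E3 | proj₀ x ∈ Ω ∧ x 2 = u (proj₀ x)}

end MaximalSurface

/-! It suffices to prove `f ≤ 0` and to apply this to `-f` as well. Put `ψ = ⟨X - X p₀, X - X p₀⟩`.
On the interior the coordinates of `X` are harmonic, and discarding the timelike normal part of a
vector does not decrease its Lorentzian square; together these give `|∇ψ|² ≥ ψ Δψ`. So `log ψ` is
superharmonic where `ψ > 0`, and the slower function `ε log (1 + log (ψ / c))` is strictly
superharmonic where `ψ > c`. If `ψ` tends to infinity at infinity in `M`, this is a barrier: letting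
`ε → 0` shows that `f` is bounded by `0` or by its maximum over a compact part
(`le_of_le_on_compact`). A positive maximum would be interior, and the strong maximum principle
would make `f` a positive constant, which contradicts `f = 0` on the nonempty boundary
(`nonpos_of_starConvex`).

The growth of `ψ` comes from `|u ξ - u z₀| ≤ |ξ - z₀| - δ` outside a disc about `z₀ = proj₀ (X p₀)`
(`exists_height_estimate`). The gain `δ` is due to the strict contraction of `u` near `z₀`; beyond
the disc one needs `u` to be `1`-Lipschitz along rays from `z₀`, which lie over `Ω` by starlikeness.

Interior points cause no trouble, since a spacelike graph is locally a strict contraction there.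
Over the boundary the metric is uncontrolled and `u` need not be continuous a priori. However, the
image of the boundary has dimension at most one, so by Fubini, on almost every ray, `u ± r` maps the
boundary parameters to a null set (`ae_ray_null`). A continuous function that decreases off such a
set decreases. Continuity itself follows from the closed graph, by properness, together with Baire's
theorem (`ClosedGraphOn.abs_sub_le`). The remaining rays and the boundary points are reached by
continuity and density. -/

section ClosedGraph

/-! ### Functions of one variable with closed graph -/

open Set Filter Topology MeasureTheory

/-- If `g - id` is continuous, maps the exceptional set `S` to a null set and decreases to the
right of every point outside `S`, then it decreases. -/
theorem sub_le_sub_of_null_image {g : ℝ → ℝ} {a b : ℝ} {S : Set ℝ} (hab : a ≤ b)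
    (hg : ContinuousOn g (Icc a b))
    (hloc : ∀ t ∈ Icc a b, t ∉ S → ∀ᶠ s in 𝓝[>] t, g s - s < g t - t)
    (hnull : volume ((fun t => g t - t) '' S) = 0) : g b - g a ≤ b - a := by
  by_contra! hlt
  have hlt' : g a - a < g b - b := by linarith
  -- A null set cannot cover an interval, so some intermediate value `y` is not taken on `S`. The
  -- last `t` with `g t - t ≤ y` takes the value `y`, hence lies off `S`, yet `g - id` exceeds `y`
  -- just to its right.
  obtain ⟨y, hy, hyS⟩ : ∃ y ∈ Ioo (g a - a) (g b - b), y ∉ (fun t => g t - t) '' S := by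
    by_contra! hsub
    have h1 : volume (Ioo (g a - a) (g b - b)) = 0 := measure_mono_null hsub hnull
    rw [Real.volume_Ioo, ENNReal.ofReal_eq_zero] at h1
    linarith
  have hG : ContinuousOn (fun t => g t - t) (Icc a b) := hg.sub continuousOn_id
  set T := Icc a b ∩ (fun t => g t - t) ⁻¹' Iic y with hT
  have hTc : IsCompact T :=
    isCompact_Icc.of_isClosed_subset
      (hG.preimage_isClosed_of_isClosed isClosed_Icc isClosed_Iic) inter_subset_left
  have haT : a ∈ T := ⟨⟨le_rfl, hab⟩, hy.1.le⟩
  obtain ⟨t, htT, htmax⟩ := hTc.exists_isGreatest ⟨a, haT⟩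
  have htb : t < b := by
    refine lt_of_le_of_ne htT.1.2 ?_
    rintro rfl
    exact absurd htT.2 (not_le.2 hy.2)
  have hright : ∀ᶠ s in 𝓝[>] t, y < g s - s := by
    filter_upwards [Ioo_mem_nhdsGT htb] with s hs
    by_contra! hsy
    exact absurd (htmax ⟨⟨htT.1.1.trans hs.1.le, hs.2.le⟩, hsy⟩) (not_le.2 hs.1)
  have hge : y ≤ g t - t := by
    have hc : Tendsto (fun t => g t - t) (𝓝[>] t) (𝓝 (g t - t)) := by
      refine (hG t htT.1).mono_left ?_
      rw [← nhdsWithin_Ioo_eq_nhdsGT htb]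
      exact nhdsWithin_mono _ fun s hs => ⟨htT.1.1.trans hs.1.le, hs.2.le⟩
    exact ge_of_tendsto hc (hright.mono fun _ h => h.le)
  have hty : g t - t = y := le_antisymm htT.2 hge
  have htS : t ∉ S := fun h => hyS ⟨t, h, hty⟩
  obtain ⟨s, hs1, hs2⟩ := ((hloc t htT.1 htS).and hright).exists
  linarith

/-- `g` is, outside an exceptional set, locally a contraction on `[a, b]`, and `g - id`, `g + id`
map the exceptional set to null sets. -/
structure ContractingOffNull (g : ℝ → ℝ) (a b : ℝ) (S : Set ℝ) : Prop where
  contracting : ∀ t ∈ Icc a b, t ∉ S → ∃ κ < (1 : ℝ), ∀ᶠ s in 𝓝 t, |g s - g t| ≤ κ * |s - t|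
  null_sub : volume ((fun t => g t - t) '' S) = 0
  null_add : volume ((fun t => g t + t) '' S) = 0

namespace ContractingOffNull

variable {g : ℝ → ℝ} {a b c d : ℝ} {S : Set ℝ}

theorem mono (h : ContractingOffNull g a b S) (hs : Icc c d ⊆ Icc a b) :
    ContractingOffNull g c d S :=
  ⟨fun t ht => h.contracting t (hs ht), h.null_sub, h.null_add⟩

theorem neg (h : ContractingOffNull g a b S) : ContractingOffNull (-g) a b S := by
  have key : ∀ A : Set ℝ, volume A = 0 → volume (-A) = 0 := fun A hA => by
    rwa [Measure.measure_neg]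
  refine ⟨fun t ht hS => ?_, ?_, ?_⟩
  · obtain ⟨κ, hκ, hev⟩ := h.contracting t ht hS
    refine ⟨κ, hκ, hev.mono fun s hs => ?_⟩
    have : (-g) s - (-g) t = -(g s - g t) := by simp only [Pi.neg_apply]; ring
    rwa [this, abs_neg]
  · convert key _ h.null_add using 2
    rw [← Set.image_neg_eq_neg, image_image]
    refine image_congr fun t _ => ?_
    simp only [Pi.neg_apply]; ring
  · convert key _ h.null_sub using 2
    rw [← Set.image_neg_eq_neg, image_image]
    refine image_congr fun t _ => ?_
    simp only [Pi.neg_apply]; ring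

theorem sub_le_of_continuousOn (h : ContractingOffNull g a b S) (hab : a ≤ b)
    (hg : ContinuousOn g (Icc a b)) : g b - g a ≤ b - a := by
  refine sub_le_sub_of_null_image hab hg (fun t ht hS => ?_) h.null_sub
  obtain ⟨κ, hκ, hev⟩ := h.contracting t ht hS
  filter_upwards [hev.filter_mono nhdsWithin_le_nhds, self_mem_nhdsWithin] with s hs hts
  have hpos : 0 < s - t := sub_pos.2 hts
  rw [abs_of_pos hpos] at hs
  nlinarith [le_abs_self (g s - g t)]

theorem abs_sub_le_of_continuousOn (h : ContractingOffNull g a b S) (hab : a ≤ b)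
    (hg : ContinuousOn g (Icc a b)) : |g b - g a| ≤ b - a := by
  have h1 := h.sub_le_of_continuousOn hab hg
  have h2 := h.neg.sub_le_of_continuousOn hab hg.neg
  simp only [Pi.neg_apply] at h2
  exact abs_le.2 ⟨by linarith, by linarith⟩

end ContractingOffNull

/-- The graph of `g` over `[a, b]` is closed. -/
def ClosedGraphOn (g : ℝ → ℝ) (a b : ℝ) : Prop :=
  IsClosed {q : ℝ × ℝ | q.1 ∈ Icc a b ∧ q.2 = g q.1}

namespace ClosedGraphOn

variable {g : ℝ → ℝ} {a b c d : ℝ} {S : Set ℝ}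

/-- The set is the projection of a compact piece of the graph; truncating by `n` supplies the
compactness. -/
theorem isClosed_preimage (h : ClosedGraphOn g a b) (n : ℝ) {C : Set ℝ} (hC : IsClosed C) :
    IsClosed {t | t ∈ Icc a b ∧ |g t| ≤ n ∧ g t ∈ C} := by
  have hK : IsCompact ({q : ℝ × ℝ | q.1 ∈ Icc a b ∧ q.2 = g q.1} ∩
      Icc a b ×ˢ (Icc (-n) n ∩ C)) :=
    (isCompact_Icc.prod (isCompact_Icc.inter_right hC)).inter_left h
  convert (hK.image continuous_fst).isClosed using 1
  ext t
  constructor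
  · rintro ⟨h1, h2, h3⟩
    exact ⟨(t, g t), ⟨⟨h1, rfl⟩, h1, abs_le.1 h2, h3⟩, rfl⟩
  · rintro ⟨⟨t', y⟩, ⟨⟨h1, h2⟩, h3, h4, h5⟩, rfl⟩
    simp only at h1 h2 h3 h4 h5 ⊢
    subst h2
    exact ⟨h1, abs_le.2 h4, h5⟩

theorem continuousOn (h : ClosedGraphOn g a b) (hs : Icc c d ⊆ Icc a b) {n : ℝ}
    (hn : ∀ t ∈ Icc c d, |g t| ≤ n) : ContinuousOn g (Icc c d) := by
  rw [continuousOn_iff_isClosed]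
  intro C hC
  refine ⟨_, h.isClosed_preimage n hC, ?_⟩
  ext t
  constructor
  · rintro ⟨h1, h2⟩
    exact ⟨⟨hs h2, hn t h2, h1⟩, h2⟩
  · rintro ⟨⟨_, _, h1⟩, h2⟩
    exact ⟨h1, h2⟩

theorem abs_sub_le_of_bounded (h : ClosedGraphOn g a b) (hS : ContractingOffNull g a b S)
    (hs : Icc c d ⊆ Icc a b) (hcd : c ≤ d) (hn : ∃ n, ∀ t ∈ Icc c d, |g t| ≤ n) :
    |g d - g c| ≤ d - c := by
  obtain ⟨n, hn⟩ := hn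
  exact (hS.mono hs).abs_sub_le_of_continuousOn hcd (h.continuousOn hs hn)

/-- The Lipschitz bound from `d` controls `g` uniformly on `(c, d]`, so boundedness extends to `c`.
This is used on a gap of the set of bad points, whose endpoint `c` may be bad. -/
theorem abs_sub_le_of_bounded_Ioc (h : ClosedGraphOn g a b) (hS : ContractingOffNull g a b S)
    (hs : Icc c d ⊆ Icc a b) (hcd : c ≤ d)
    (hn : ∀ s ∈ Ioc c d, ∃ n, ∀ t ∈ Icc s d, |g t| ≤ n) : |g d - g c| ≤ d - c := by
  refine h.abs_sub_le_of_bounded hS hs hcd ⟨max |g c| (|g d| + (d - c)), fun t ht => ?_⟩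
  rcases ht.1.eq_or_lt with rfl | hct
  · exact le_max_left _ _
  · have h1 := h.abs_sub_le_of_bounded hS ((Icc_subset_Icc_left ht.1).trans hs) ht.2
      (hn t ⟨hct, ht.2⟩)
    refine le_max_of_le_right ?_
    have := abs_sub_abs_le_abs_sub (g t) (g d)
    rw [abs_sub_comm] at this
    linarith

theorem abs_sub_le_of_bounded_Ico (h : ClosedGraphOn g a b) (hS : ContractingOffNull g a b S)
    (hs : Icc c d ⊆ Icc a b) (hcd : c ≤ d)
    (hn : ∀ s ∈ Ico c d, ∃ n, ∀ t ∈ Icc c s, |g t| ≤ n) : |g d - g c| ≤ d - c := by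
  refine h.abs_sub_le_of_bounded hS hs hcd ⟨max |g d| (|g c| + (d - c)), fun t ht => ?_⟩
  rcases ht.2.eq_or_lt with rfl | hct
  · exact le_max_left _ _
  · have h1 := h.abs_sub_le_of_bounded hS ((Icc_subset_Icc_right ht.2).trans hs) ht.1
      (hn t ⟨ht.1, hct⟩)
    refine le_max_of_le_right ?_
    have := abs_sub_abs_le_abs_sub (g t) (g c)
    linarith

end ClosedGraphOn

theorem bounded_Icc_of_locally_bounded {g : ℝ → ℝ} {a b c d : ℝ} (hs : Icc c d ⊆ Icc a b)
    (hloc : ∀ t ∈ Icc c d, ∃ n : ℝ, ∀ᶠ s in 𝓝[Icc a b] t, |g s| ≤ n) :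
    ∃ n, ∀ t ∈ Icc c d, |g t| ≤ n := by
  refine isCompact_Icc.induction_on (p := fun A => ∃ n, ∀ t ∈ A, |g t| ≤ n) ⟨0, by simp⟩ ?_ ?_ ?_
  · rintro A B hAB ⟨n, hn⟩
    exact ⟨n, fun t ht => hn t (hAB ht)⟩
  · rintro A B ⟨n, hn⟩ ⟨m, hm⟩
    refine ⟨max n m, fun t ht => ?_⟩
    rcases ht with ht | ht
    · exact le_max_of_le_left (hn t ht)
    · exact le_max_of_le_right (hm t ht)
  · intro t ht
    obtain ⟨n, hn⟩ := hloc t ht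
    exact ⟨_, nhdsWithin_mono _ hs hn, n, fun s hs => hs⟩

/-- A function with closed graph on an interval which is locally a contraction outside an
exceptional set `S`, such that `g - id` and `g + id` map `S` to null sets, is `1`-Lipschitz. By
Baire's theorem the set of points near which `g` is unbounded has to be empty. -/
theorem ClosedGraphOn.abs_sub_le {g : ℝ → ℝ} {a b : ℝ} {S : Set ℝ} (h : ClosedGraphOn g a b)
    (hS : ContractingOffNull g a b S) (hab : a ≤ b) : |g b - g a| ≤ b - a := by
  set D : Set ℝ := {t | t ∈ Icc a b ∧ ¬ ∃ n : ℝ, ∀ᶠ s in 𝓝[Icc a b] t, |g s| ≤ n} with hD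
  have hDc : IsClosed D := by
    rw [← isOpen_compl_iff, isOpen_iff_mem_nhds]
    intro t ht
    by_cases htI : t ∈ Icc a b
    · have : ∃ n : ℝ, ∀ᶠ s in 𝓝[Icc a b] t, |g s| ≤ n := by
        by_contra hc; exact ht ⟨htI, hc⟩
      obtain ⟨n, hn⟩ := this
      have h2 := eventually_nhdsWithin_iff.1 (eventually_eventually_nhdsWithin.2 hn)
      filter_upwards [h2] with s hs hsD
      exact hsD.2 ⟨n, hs hsD.1⟩
    · filter_upwards [isClosed_Icc.isOpen_compl.mem_nhds htI] with s hs hsD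
      exact hs hsD.1
  have hloc : ∀ t ∈ Icc a b, t ∉ D → ∃ n : ℝ, ∀ᶠ s in 𝓝[Icc a b] t, |g s| ≤ n := by
    intro t ht htD
    by_contra hc
    exact htD ⟨ht, hc⟩
  suffices hDe : D = ∅ by
    refine h.abs_sub_le_of_bounded hS Subset.rfl hab (bounded_Icc_of_locally_bounded Subset.rfl ?_)
    intro t ht
    exact hloc t ht (by simp [hDe])
  by_contra hne
  obtain ⟨x0, hx0⟩ := nonempty_iff_ne_empty.2 hne
  have : Nonempty D := ⟨⟨x0, hx0⟩⟩
  have : CompleteSpace D := hDc.completeSpace_coe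
  -- The closed sets `|g| ≤ n` cover the complete space `D`, so by Baire `g` is bounded by some `n`
  -- on `D` near `t0`.
  obtain ⟨n, ⟨t0, ht0D⟩, ht0⟩ := nonempty_interior_of_iUnion_of_closed
    (f := fun n : ℕ => {x : D | |g x| ≤ n})
    (fun n => by
      convert (h.isClosed_preimage n isClosed_univ).preimage (continuous_subtype_val (p := (· ∈ D)))
        using 1
      ext x
      simpa using fun _ => x.2.1)
    (by
      ext x
      simpa using exists_nat_ge |g x|)
  obtain ⟨η, hη, hball⟩ := Metric.mem_nhds_iff.1 (mem_interior_iff_mem_nhds.1 ht0)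
  have hbd : ∀ t ∈ D, |t - t0| < η → |g t| ≤ n := fun t ht htt =>
    @hball ⟨t, ht⟩ (by rw [Metric.mem_ball, Subtype.dist_eq]; exact htt)
  -- From `t`, go towards `t0` to the first point `e` of `D`. There `|g e| ≤ n`, and across the gap,
  -- of length less than `η`, `g` changes by at most that length.
  refine ht0D.2 ⟨n + η, ?_⟩
  filter_upwards [inter_mem_nhdsWithin _ (Metric.ball_mem_nhds t0 hη)] with t ht
  obtain ⟨htI, htη⟩ := ht
  rw [Metric.mem_ball, Real.dist_eq] at htη
  rcases le_total t0 t with hle | hle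
  · obtain ⟨e, heT, hemax⟩ := ((isCompact_Icc (a := t0) (b := t)).inter_left hDc).exists_isGreatest
      ⟨t0, ht0D, le_rfl, hle⟩
    have hsub : Icc e t ⊆ Icc a b := Icc_subset_Icc heT.1.1.1 htI.2
    have h1 : |g t - g e| ≤ t - e := by
      refine h.abs_sub_le_of_bounded_Ioc hS hsub heT.2.2 fun s hs => ?_
      refine bounded_Icc_of_locally_bounded ((Icc_subset_Icc_left hs.1.le).trans hsub)
        fun r hr => hloc r (hsub ⟨hs.1.le.trans hr.1, hr.2⟩) fun hrD => ?_
      have := hemax ⟨hrD, heT.2.1.trans (hs.1.le.trans hr.1), hr.2⟩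
      linarith [hs.1, hr.1]
    rw [abs_of_nonneg (sub_nonneg.2 hle)] at htη
    have h2 := hbd e heT.1 (by rw [abs_of_nonneg (sub_nonneg.2 heT.2.1)]; linarith [heT.2.2])
    have := abs_sub_abs_le_abs_sub (g t) (g e)
    linarith [heT.2.1]
  · obtain ⟨e, heT, hemin⟩ := ((isCompact_Icc (a := t) (b := t0)).inter_left hDc).exists_isLeast
      ⟨t0, ht0D, hle, le_rfl⟩
    have hsub : Icc t e ⊆ Icc a b := Icc_subset_Icc htI.1 heT.1.1.2
    have h1 : |g e - g t| ≤ e - t := by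
      refine h.abs_sub_le_of_bounded_Ico hS hsub heT.2.1 fun s hs => ?_
      refine bounded_Icc_of_locally_bounded ((Icc_subset_Icc_right hs.2.le).trans hsub)
        fun r hr => hloc r (hsub ⟨hr.1, hr.2.trans hs.2.le⟩) fun hrD => ?_
      have := hemin ⟨hrD, hr.1, (hr.2.trans hs.2.le).trans heT.2.2⟩
      linarith [hs.2, hr.2]
    rw [abs_sub_comm, abs_of_nonneg (sub_nonneg.2 hle)] at htη
    have h2 := hbd e heT.1 (by
      rw [abs_sub_comm, abs_of_nonneg (sub_nonneg.2 heT.2.2)]; linarith [heT.2.1])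
    have := abs_sub_abs_le_abs_sub (g t) (g e)
    rw [abs_sub_comm] at this
    linarith [heT.2.2]

end ClosedGraph

namespace MaximalSurface

open Set Filter Topology Complex

/-! ### Lorentzian linear algebra -/

section LinearAlgebra

theorem lorentz_comm (x y : E3) : lorentz x y = lorentz y x := by
  simp only [lorentz]; ring

theorem lorentz_add_left (x y w : E3) : lorentz (x + y) w = lorentz x w + lorentz y w := by
  simp only [lorentz, PiLp.add_apply]; ring

theorem lorentz_smul_left (c : ℝ) (x w : E3) : lorentz (c • x) w = c * lorentz x w := by
  simp only [lorentz, PiLp.smul_apply, smul_eq_mul]; ring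

theorem lorentz_smul_right (c : ℝ) (x w : E3) : lorentz x (c • w) = c * lorentz x w := by
  simp only [lorentz, PiLp.smul_apply, smul_eq_mul]; ring

theorem lorentz_zero_left (w : E3) : lorentz 0 w = 0 := by simp [lorentz]

/-- The Lorentzian cross product. -/
noncomputable def lorentzCross (a b : E3) : E3 :=
  !₂[a 1 * b 2 - a 2 * b 1, a 2 * b 0 - a 0 * b 2, -(a 0 * b 1 - a 1 * b 0)]

theorem lorentz_left_lorentzCross (a b : E3) : lorentz a (lorentzCross a b) = 0 := by
  simp [lorentz, lorentzCross]; ring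

theorem lorentz_right_lorentzCross (a b : E3) : lorentz b (lorentzCross a b) = 0 := by
  simp [lorentz, lorentzCross]; ring

theorem lorentz_lorentzCross_self (a b : E3) :
    lorentz (lorentzCross a b) (lorentzCross a b) =
      -(lorentz a a * lorentz b b - lorentz a b ^ 2) := by
  simp [lorentz, lorentzCross]; ring

/-- Expansion in the frame `a`, `b`, `lorentzCross a b`. The last vector has square minus the Gram
determinant, whence the minus sign; pairing with `w` gives `gram_mul_lorentz_self`. -/
theorem gram_smul_eq (a b w : E3) :
    (lorentz a a * lorentz b b - lorentz a b ^ 2) • w =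
      (lorentz b b * lorentz w a - lorentz a b * lorentz w b) • a +
      (lorentz a a * lorentz w b - lorentz a b * lorentz w a) • b -
      lorentz w (lorentzCross a b) • lorentzCross a b := by
  ext i
  fin_cases i <;> simp [lorentz, lorentzCross] <;> ring

theorem gram_mul_lorentz_self (a b w : E3) :
    (lorentz a a * lorentz b b - lorentz a b ^ 2) * lorentz w w =
      lorentz b b * lorentz w a ^ 2 - 2 * lorentz a b * lorentz w a * lorentz w b +
      lorentz a a * lorentz w b ^ 2 - lorentz w (lorentzCross a b) ^ 2 := by
  simp [lorentz, lorentzCross]; ring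

/-- For a conformal spacelike frame the tangential part of a vector has larger Lorentzian norm than
the vector. -/
theorem mul_lorentz_self_le {a b w : E3} (hE : lorentz a a = lorentz b b) (hF : lorentz a b = 0)
    (hpos : 0 < lorentz a a) :
    lorentz a a * lorentz w w ≤ lorentz w a ^ 2 + lorentz w b ^ 2 := by
  have h := gram_mul_lorentz_self a b w
  rw [hF, ← hE] at h
  have h2 : lorentz a a * (lorentz a a * lorentz w w) ≤
      lorentz a a * (lorentz w a ^ 2 + lorentz w b ^ 2) := by
    nlinarith [sq_nonneg (lorentz w (lorentzCross a b))]
  exact le_of_mul_le_mul_left h2 hpos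

/-- The projection to the plane `{x₃ = 0}` as a continuous linear map. -/
noncomputable def projL : E3 →L[ℝ] ℂ :=
  LinearMap.toContinuousLinearMap
    { toFun := proj₀
      map_add' := fun x y => by apply Complex.ext <;> simp [proj₀]
      map_smul' := fun c x => by apply Complex.ext <;> simp [proj₀] }

theorem proj₀_sub (x y : E3) : proj₀ (x - y) = proj₀ x - proj₀ y := projL.map_sub x y

theorem continuous_proj₀ : Continuous proj₀ := projL.continuous

theorem norm_proj₀_sq (x : E3) : ‖proj₀ x‖ ^ 2 = x 0 ^ 2 + x 1 ^ 2 := by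
  rw [← Complex.normSq_eq_norm_sq, Complex.normSq_apply]; simp [proj₀]; ring

theorem lorentz_self (x : E3) : lorentz x x = ‖proj₀ x‖ ^ 2 - x 2 ^ 2 := by
  rw [norm_proj₀_sq, lorentz]; ring

theorem norm_sq_eq (x : E3) : ‖x‖ ^ 2 = ‖proj₀ x‖ ^ 2 + x 2 ^ 2 := by
  rw [norm_proj₀_sq, EuclideanSpace.norm_sq_eq, Fin.sum_univ_three]; simp

theorem norm_proj₀_le (x : E3) : ‖proj₀ x‖ ≤ ‖x‖ :=
  abs_le_of_sq_le_sq' (by rw [norm_sq_eq]; nlinarith [sq_nonneg (x 2)]) (norm_nonneg _) |>.2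

theorem abs_height_le (x : E3) : |x 2| ≤ ‖x‖ :=
  abs_le_of_sq_le_sq (by rw [norm_sq_eq]; nlinarith [sq_nonneg ‖proj₀ x‖]) (norm_nonneg _)

end LinearAlgebra

/-! ### Harmonic coordinates and a local maximum principle -/

section LocalGeometry

theorem hasDerivAt_lorentz {F G : ℝ → E3} {F' G' : E3} {s : ℝ} (hF : HasDerivAt F F' s)
    (hG : HasDerivAt G G' s) :
    HasDerivAt (fun s => lorentz (F s) (G s)) (lorentz F' (G s) + lorentz (F s) G') s := by
  have hF := fun i : Fin 3 =>
    (EuclideanSpace.proj (𝕜 := ℝ) i).hasFDerivAt.comp_hasDerivAt s hF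
  have hG := fun i : Fin 3 =>
    (EuclideanSpace.proj (𝕜 := ℝ) i).hasFDerivAt.comp_hasDerivAt s hG
  have := (((hF 0).mul (hG 0)).add ((hF 1).mul (hG 1))).sub ((hF 2).mul (hG 2))
  refine this.congr_deriv ?_
  simp [lorentz]; ring

theorem hasDerivAt_line {V : Type*} [NormedAddCommGroup V] [NormedSpace ℝ V] {F : ℂ → V} {z a : ℂ}
    {s : ℝ} (hF : DifferentiableAt ℝ F (z + s • a)) :
    HasDerivAt (fun s : ℝ => F (z + s • a)) (fderiv ℝ F (z + s • a) a) s := by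
  have hl : HasDerivAt (fun s : ℝ => z + s • a) a s := by
    simpa using ((hasDerivAt_id s).smul_const a).const_add z
  exact hF.hasFDerivAt.comp_hasDerivAt s hl

theorem tendsto_line (z a : ℂ) : Tendsto (fun s : ℝ => z + s • a) (𝓝 0) (𝓝 z) := by
  have : Continuous fun s : ℝ => z + s • a := by fun_prop
  simpa using this.tendsto 0

/-- A positive second derivative would also give a local minimum, so `k` would be locally constant
and its second derivative zero. -/
theorem second_deriv_nonpos_of_isLocalMax {k k' : ℝ → ℝ} {k2 : ℝ}
    (hk : ∀ᶠ s in 𝓝 0, HasDerivAt k (k' s) s) (hk2 : HasDerivAt k' k2 0)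
    (hmax : IsLocalMax k 0) : k2 ≤ 0 := by
  by_contra! hpos
  have hd : deriv k =ᶠ[𝓝 0] k' := hk.mono fun s hs => hs.deriv
  have hdd : deriv (deriv k) 0 = k2 := by rw [hd.deriv_eq, hk2.deriv]
  have hmin : IsLocalMin k 0 :=
    isLocalMin_of_deriv_deriv_pos (by rwa [hdd]) hmax.deriv_eq_zero hk.self_of_nhds.continuousAt
  have hconst : k =ᶠ[𝓝 0] fun _ => k 0 := by
    filter_upwards [hmin, hmax] with s h1 h2 using le_antisymm h2 h1
  have h0 : deriv k =ᶠ[𝓝 0] fun _ => 0 := by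
    filter_upwards [hconst.eventuallyEq_nhds] with s hs
    rw [hs.deriv_eq, deriv_const]
  rw [h0.deriv_eq, deriv_const] at hdd
  exact hpos.ne hdd

theorem differentiableAt_D {Y : ℂ → E3} {z : ℂ} (hY : ContDiffAt ℝ 2 Y z) (a : ℂ) :
    DifferentiableAt ℝ (D Y a) z :=
  ((hY.fderiv_right (m := 1) le_rfl).differentiableAt one_ne_zero).clm_apply
    (differentiableAt_const a)

theorem eventually_differentiableAt {V : Type*} [NormedAddCommGroup V] [NormedSpace ℝ V]
    {Y : ℂ → V} {z : ℂ} (hY : ContDiffAt ℝ 2 Y z) : ∀ᶠ w in 𝓝 z, DifferentiableAt ℝ Y w :=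
  (hY.eventually (by simp)).mono fun _ hw => hw.differentiableAt two_ne_zero

theorem D_D_comm {Y : ℂ → E3} {z : ℂ} (hY : ContDiffAt ℝ 2 Y z) (a b : ℂ) :
    D (D Y a) b z = D (D Y b) a z := by
  have hd : DifferentiableAt ℝ (fderiv ℝ Y) z :=
    (hY.fderiv_right (m := 1) le_rfl).differentiableAt one_ne_zero
  have key : ∀ a b : ℂ, D (D Y a) b z = fderiv ℝ (fderiv ℝ Y) z b a := by
    intro a b
    have : D Y a = fun w => fderiv ℝ Y w a := rfl
    rw [D, this, fderiv_clm_apply hd (differentiableAt_const a)]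
    simp
  rw [key, key]
  exact (hY.isSymmSndFDerivAt (by simp)) b a

theorem D_eq (Y : ℂ → E3) (z a : ℂ) : D Y a z = a.re • D Y 1 z + a.im • D Y I z := by
  have : a = a.re • (1 : ℂ) + a.im • I := by
    apply Complex.ext <;> simp
  conv_lhs => rw [this]
  simp only [D, map_add, map_smul]

theorem firstForm_self_eq {Y : ℂ → E3} {z : ℂ} (h : IsothermalAt Y z) (a : ℂ) :
    firstForm Y z a a = firstForm Y z 1 1 * ‖a‖ ^ 2 := by
  obtain ⟨h1, h2⟩ := h
  simp only [firstForm] at *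
  rw [← Complex.normSq_eq_norm_sq, Complex.normSq_apply, D_eq Y z a]
  simp only [lorentz, PiLp.add_apply, PiLp.smul_apply, smul_eq_mul] at *
  linear_combination -(a.im ^ 2) * h1 + 2 * a.re * a.im * h2

theorem hasDerivAt_firstForm {Y : ℂ → E3} {z : ℂ} (hY : ContDiffAt ℝ 2 Y z) (a b c : ℂ) :
    HasDerivAt (fun s : ℝ => firstForm Y (z + s • c) a b)
      (lorentz (D (D Y a) c z) (D Y b z) + lorentz (D Y a z) (D (D Y b) c z)) 0 := by
  have h := fun a => hasDerivAt_line (F := D Y a) (z := z) (a := c) (s := 0)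
    (by simpa using differentiableAt_D hY a)
  simpa [D, firstForm] using hasDerivAt_lorentz (h a) (h b)

/-- The coordinates of a conformal maximal immersion are harmonic. -/
theorem laplacian_eq_zero {Y : ℂ → E3} {z : ℂ} (hY : ContDiffAt ℝ 2 Y z)
    (hiso : ∀ᶠ w in 𝓝 z, IsothermalAt Y w) (hsp : SpacelikeAt Y z)
    (hmax : ∀ N, IsUnitNormal Y z N → meanCurvature Y N z = 0) :
    D (D Y 1) 1 z + D (D Y I) I z = 0 := by
  have hpos : 0 < lorentz (D Y 1 z) (D Y 1 z) := hsp 1 one_ne_zero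
  obtain ⟨hE, hF⟩ : lorentz (D Y 1 z) (D Y 1 z) = lorentz (D Y I z) (D Y I z) ∧
    lorentz (D Y 1 z) (D Y I z) = 0 := hiso.self_of_nhds
  have hline : ∀ c : ℂ, ∀ᶠ s : ℝ in 𝓝 0, IsothermalAt Y (z + s • c) := fun c =>
    (tendsto_line z c).eventually hiso
  -- Differentiating the two conformality relations shows that the Laplacian vector is orthogonal to
  -- the tangent plane; zero mean curvature then removes its normal component.
  have e1 : ∀ c : ℂ, lorentz (D (D Y 1) c z) (D Y 1 z) = lorentz (D (D Y I) c z) (D Y I z) := by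
    intro c
    have h1 := hasDerivAt_firstForm hY 1 1 c
    have h2 := (hasDerivAt_firstForm hY I I c).congr_of_eventuallyEq
      ((hline c).mono fun s hs => hs.1)
    have := h1.unique h2
    rw [lorentz_comm (D Y 1 z), lorentz_comm (D Y I z)] at this
    linarith
  have e2 : ∀ c : ℂ, lorentz (D (D Y 1) c z) (D Y I z) + lorentz (D (D Y I) c z) (D Y 1 z) = 0 := by
    intro c
    have h1 := hasDerivAt_firstForm hY 1 I c
    have h2 := (hasDerivAt_const (0 : ℝ) (0 : ℝ)).congr_of_eventuallyEq
      (f₁ := fun s : ℝ => firstForm Y (z + s • c) 1 I) ((hline c).mono fun s hs => hs.2)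
    have := h1.unique h2
    rwa [lorentz_comm (D Y 1 z)] at this
  have hc := D_D_comm hY 1 I
  set A := D Y 1 z
  set B := D Y I z
  set W := D (D Y 1) 1 z + D (D Y I) I z with hW
  set n := lorentzCross A B
  have hWA : lorentz W A = 0 := by
    have h1 := e1 1
    have h2 := e2 I
    rw [hW, lorentz_add_left]
    rw [hc] at h2
    linarith
  have hWB : lorentz W B = 0 := by
    have h1 := e1 I
    have h2 := e2 1
    rw [hW, lorentz_add_left]
    rw [hc] at h1
    linarith
  have hWn : lorentz W n = 0 := by
    have hN : IsUnitNormal Y z ((lorentz A A)⁻¹ • n) := by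
      constructor
      · rw [lorentz_smul_left, lorentz_smul_right, lorentz_lorentzCross_self, ← hE, hF]
        field_simp
        simp
      · intro a
        rw [D_eq, lorentz_smul_right, lorentz_add_left, lorentz_smul_left, lorentz_smul_left,
          lorentz_left_lorentzCross, lorentz_right_lorentzCross]
        simp
    have h := hmax _ hN
    rw [meanCurvature, div_eq_zero_iff] at h
    simp only [secondForm, firstForm, lorentz_smul_right] at h
    change _ ∨ 2 * (lorentz A A * lorentz B B - lorentz A B ^ 2) = 0 at h
    change (lorentz A A)⁻¹ * lorentz (D (D Y 1) 1 z) n * lorentz B B -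
      2 * ((lorentz A A)⁻¹ * lorentz (D (D Y I) 1 z) n) * lorentz A B +
      (lorentz A A)⁻¹ * lorentz (D (D Y I) I z) n * lorentz A A = 0 ∨ _ at h
    rw [← hE, hF] at h
    rcases h with h | h
    · field_simp at h
      rw [hW, lorentz_add_left]
      refine (mul_eq_zero.1 (?_ : lorentz A A * _ = 0)).resolve_left hpos.ne'
      linarith
    · nlinarith
  have h := gram_smul_eq A B W
  rw [hWA, hWB, hWn, ← hE, hF] at h
  simp only [mul_zero, sub_self, zero_smul, add_zero, smul_eq_zero] at h
  refine h.resolve_left ?_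
  nlinarith

/-- A local strict maximum principle: a harmonic function minus a concave increasing function of
the Lorentzian norm of a maximal surface cannot have a local maximum, if the concave function grows
more slowly than the logarithm. -/
theorem not_isLocalMax_sub_comp_lorentz {Y : ℂ → E3} {z : ℂ} (hY : ContDiffAt ℝ 2 Y z)
    (hiso : IsothermalAt Y z) (hsp : SpacelikeAt Y z)
    (hlap : D (D Y 1) 1 z + D (D Y I) I z = 0) (x₀ : E3) {h : ℂ → ℝ}
    (hh : InnerProductSpace.HarmonicAt h z) {φ φ' : ℝ → ℝ} {φ2 : ℝ}
    (hφ : ∀ᶠ t in 𝓝 (lorentz (Y z - x₀) (Y z - x₀)), HasDerivAt φ (φ' t) t)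
    (hφ' : HasDerivAt φ' φ2 (lorentz (Y z - x₀) (Y z - x₀)))
    (hφ2 : φ2 ≤ 0)
    (hlt : φ' (lorentz (Y z - x₀) (Y z - x₀)) + lorentz (Y z - x₀) (Y z - x₀) * φ2 < 0) :
    ¬ IsLocalMax (fun w => h w - φ (lorentz (Y w - x₀) (Y w - x₀))) z := by
  intro hmax
  set v := Y z - x₀ with hv
  have hψc : ContinuousAt (fun w => lorentz (Y w - x₀) (Y w - x₀)) z := by
    have hc : ContinuousAt (fun w => Y w - x₀) z := hY.continuousAt.sub continuousAt_const
    have hl : Continuous fun x : E3 => lorentz x x := by unfold lorentz; fun_prop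
    exact hl.continuousAt.comp hc
  have key : ∀ a : ℂ, fderiv ℝ (fun w => fderiv ℝ h w a) z a -
      (φ2 * (2 * lorentz (D Y a z) v) * (2 * lorentz (D Y a z) v) +
        φ' (lorentz v v) * (2 * (lorentz (D (D Y a) a z) v + lorentz (D Y a z) (D Y a z)))) ≤ 0 := by
    intro a
    have hYl : ∀ᶠ s : ℝ in 𝓝 0, HasDerivAt (fun s : ℝ => Y (z + s • a) - x₀) (D Y a (z + s • a)) s :=
      ((tendsto_line z a).eventually (eventually_differentiableAt hY)).mono fun s hs =>
        (hasDerivAt_line hs).sub_const _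
    have hhl : ∀ᶠ s : ℝ in 𝓝 0, HasDerivAt (fun s : ℝ => h (z + s • a))
        (fderiv ℝ h (z + s • a) a) s :=
      ((tendsto_line z a).eventually (eventually_differentiableAt hh.1)).mono fun s hs =>
        hasDerivAt_line hs
    have hψl : ∀ᶠ s : ℝ in 𝓝 0, HasDerivAt
        (fun s : ℝ => lorentz (Y (z + s • a) - x₀) (Y (z + s • a) - x₀))
        (2 * lorentz (D Y a (z + s • a)) (Y (z + s • a) - x₀)) s :=
      hYl.mono fun s hs => (hasDerivAt_lorentz hs hs).congr_deriv (by
        rw [lorentz_comm (Y (z + s • a) - x₀)]; ring)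
    have hφl := (hψc.tendsto.comp (tendsto_line z a)).eventually hφ
    refine second_deriv_nonpos_of_isLocalMax
      (k := fun s : ℝ => h (z + s • a) - φ (lorentz (Y (z + s • a) - x₀) (Y (z + s • a) - x₀)))
      (k' := fun s : ℝ => fderiv ℝ h (z + s • a) a -
        φ' (lorentz (Y (z + s • a) - x₀) (Y (z + s • a) - x₀)) *
          (2 * lorentz (D Y a (z + s • a)) (Y (z + s • a) - x₀))) ?_ ?_ ?_
    · filter_upwards [hhl, hψl, hφl] with s h1 h2 h3
      exact h1.sub (HasDerivAt.comp s h3 h2)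
    · have hd : DifferentiableAt ℝ (fun w => fderiv ℝ h w a) z :=
        ((hh.1.fderiv_right (m := 1) le_rfl).differentiableAt one_ne_zero).clm_apply
          (differentiableAt_const a)
      have h1 := hasDerivAt_line (F := fun w => fderiv ℝ h w a) (z := z) (a := a) (s := 0)
        (by simpa using hd)
      have h2 := hasDerivAt_line (F := D Y a) (z := z) (a := a) (s := 0)
        (by simpa using differentiableAt_D hY a)
      have h3 := hYl.self_of_nhds
      have h4 := hψl.self_of_nhds
      have h5 : HasDerivAt φ' φ2 (lorentz (Y (z + (0 : ℝ) • a) - x₀) (Y (z + (0 : ℝ) • a) - x₀)) := by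
        simpa using hφ'
      have h6 := h1.sub ((HasDerivAt.comp (0 : ℝ) h5 h4).mul ((hasDerivAt_lorentz h2 h3).const_mul 2))
      refine h6.congr_deriv ?_
      simp only [zero_smul, add_zero, ← hv, D, Function.comp_apply]
    · filter_upwards [(tendsto_line z a).eventually hmax] with s hs
      simpa using hs
  have h1 := key 1
  have h2 := key I
  have hΔ : fderiv ℝ (fun w => fderiv ℝ h w 1) z 1 + fderiv ℝ (fun w => fderiv ℝ h w I) z I = 0 := by
    have h3 := hh.2.self_of_nhds
    have hd : DifferentiableAt ℝ (fderiv ℝ h) z :=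
      (hh.1.fderiv_right (m := 1) le_rfl).differentiableAt one_ne_zero
    rw [InnerProductSpace.laplacian_eq_iteratedFDeriv_complexPlane] at h3
    rw [fderiv_clm_apply hd (differentiableAt_const _), fderiv_clm_apply hd (differentiableAt_const _)]
    simpa [iteratedFDeriv_two_apply] using h3
  have hpos : 0 < lorentz (D Y 1 z) (D Y 1 z) := hsp 1 one_ne_zero
  obtain ⟨hE, hF⟩ : lorentz (D Y 1 z) (D Y 1 z) = lorentz (D Y I z) (D Y I z) ∧
    lorentz (D Y 1 z) (D Y I z) = 0 := hiso
  have hl : lorentz (D (D Y 1) 1 z) v + lorentz (D (D Y I) I z) v = 0 := by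
    rw [← lorentz_add_left, hlap, lorentz_zero_left]
  have hle := mul_lorentz_self_le (w := v) hE hF hpos
  rw [lorentz_comm v (D Y 1 z), lorentz_comm v (D Y I z)] at hle
  rw [← hE] at h2
  -- With `E` the conformal factor, the Laplacian of `φ ∘ ψ` is `4 (φ'' (⟨Y_u, v⟩² + ⟨Y_v, v⟩²) + φ'
  -- E)`. Since `φ'' ≤ 0`, it is at most `4 E (φ' + ψ φ'')`, which is negative, against the two
  -- inequalities in `key`.
  have h3 : φ2 * (lorentz (D Y 1 z) v ^ 2 + lorentz (D Y I z) v ^ 2) ≤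
      φ2 * (lorentz (D Y 1 z) (D Y 1 z) * lorentz v v) := mul_le_mul_of_nonpos_left hle hφ2
  have h4 := mul_neg_of_pos_of_neg hpos hlt
  have h5 : φ' (lorentz v v) * lorentz (D (D Y 1) 1 z) v +
    φ' (lorentz v v) * lorentz (D (D Y I) I z) v = 0 := by rw [← mul_add, hl, mul_zero]
  nlinarith

end LocalGeometry

end MaximalSurface

namespace MaximalSurface

open Set Filter Topology Complex

/-! ### Spacelike surfaces as local graphs -/

section LocalGraph

variable {Y : ℂ → E3} {z : ℂ}

/-- A nonzero spacelike vector is not vertical, so the differential of the projected map is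
injective, hence surjective. -/
theorem map_nhds_proj₀_comp (hY : ContDiffAt ℝ 2 Y z) (hsp : SpacelikeAt Y z) :
    map (fun w => proj₀ (Y w)) (𝓝 z) = 𝓝 (proj₀ (Y z)) := by
  have hd : HasStrictFDerivAt Y (fderiv ℝ Y z) z := hY.hasStrictFDerivAt two_ne_zero
  have hd2 : HasStrictFDerivAt (fun w => proj₀ (Y w)) (projL ∘L fderiv ℝ Y z) z :=
    projL.hasStrictFDerivAt.comp z hd
  refine hd2.map_nhds_eq_of_surj ?_
  have hinj : Function.Injective (projL ∘L fderiv ℝ Y z : ℂ →ₗ[ℝ] ℂ) := by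
    rw [injective_iff_map_eq_zero]
    intro a ha
    by_contra hne
    have h := hsp a hne
    have ha' : proj₀ (D Y a z) = 0 := ha
    rw [firstForm, lorentz_self, ha'] at h
    simp only [norm_zero] at h
    nlinarith [sq_nonneg ((D Y a z) 2)]
  exact LinearMap.range_eq_top.2 (LinearMap.injective_iff_surjective.1 hinj)

/-- A spacelike surface is locally the graph of a strict contraction. -/
theorem eventually_abs_height_sub_le (hY : ContDiffAt ℝ 2 Y z) (hiso : IsothermalAt Y z)
    (hsp : SpacelikeAt Y z) :
    ∃ κ < (1 : ℝ), ∀ᶠ w in 𝓝 z, |Y w 2 - Y z 2| ≤ κ * ‖proj₀ (Y w) - proj₀ (Y z)‖ := by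
  set L := fderiv ℝ Y z
  set E := firstForm Y z 1 1
  have hE : 0 < E := hsp 1 one_ne_zero
  set C := ‖L‖ + 1
  have hC : 0 < C := by positivity
  have hLC : ∀ h, ‖proj₀ (L h)‖ ≤ C * ‖h‖ := fun h => by
    refine (norm_proj₀_le _).trans ((L.le_opNorm h).trans ?_)
    gcongr
    simp [C]
  -- Chosen so that `2 c C = E`: then `(‖proj₀ (L h)‖ - c ‖h‖)²` is at least `‖proj₀ (L h)‖² - E
  -- ‖h‖²`, the square of the height of `L h`.
  set c := E / (2 * C)
  have hc : 0 < c := by positivity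
  have hcE : 2 * c * C = E := by simp only [c]; field_simp
  have hquad : ∀ h, ‖proj₀ (L h)‖ ^ 2 - (L h) 2 ^ 2 = E * ‖h‖ ^ 2 := fun h => by
    rw [← lorentz_self]; exact firstForm_self_eq hiso h
  have hlin : ∀ h, |(L h) 2| ≤ ‖proj₀ (L h)‖ - c * ‖h‖ := fun h => by
    rcases eq_or_ne h 0 with rfl | hne
    · simp [proj₀]
    have hh : 0 < ‖h‖ := norm_pos_iff.2 hne
    have h1 := hquad h
    have h2 := hLC h
    have h0 := norm_nonneg (proj₀ (L h))
    have h5 : c * ‖h‖ * ‖proj₀ (L h)‖ ≤ c * ‖h‖ * (C * ‖h‖) := by gcongr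
    have h6 : c * ‖h‖ * (C * ‖h‖) * 2 = E * ‖h‖ ^ 2 := by rw [← hcE]; ring
    have h3 : c * ‖h‖ ≤ ‖proj₀ (L h)‖ := by
      have h4 : c * ‖h‖ * (C * ‖h‖) ≤ ‖proj₀ (L h)‖ * (C * ‖h‖) := by
        have : ‖proj₀ (L h)‖ * ‖proj₀ (L h)‖ ≤ ‖proj₀ (L h)‖ * (C * ‖h‖) := by gcongr
        nlinarith [sq_nonneg ((L h) 2), mul_pos hE (pow_pos hh 2)]
      exact le_of_mul_le_mul_right h4 (by positivity)
    refine abs_le_of_sq_le_sq ?_ (sub_nonneg.2 h3)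
    nlinarith [sq_nonneg (c * ‖h‖)]
  have hd : HasFDerivAt Y L z := (hY.differentiableAt two_ne_zero).hasFDerivAt
  have ho := hd.isLittleO.def (show 0 < c / 4 by positivity)
  -- The linear part gains `c ‖h‖`, and the remainder costs `c / 4 * ‖h‖` in the height and again in
  -- the projection. The surplus `c / 2 * ‖h‖` is compared with the projection through `u3`.
  refine ⟨1 - (c / 2) / (C + c / 4), by
    have : 0 < (c / 2) / (C + c / 4) := by positivity
    linarith, ho.mono fun w hw => ?_⟩
  set h := w - z
  set r := Y w - Y z - L h
  have e1 : Y w 2 - Y z 2 = (L h) 2 + r 2 := by simp [r]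
  have e2 : proj₀ (Y w) - proj₀ (Y z) = proj₀ (L h) + proj₀ r := by
    simp only [r, proj₀_sub]; ring
  have b1 := (abs_height_le r).trans hw
  have b2 := (norm_proj₀_le r).trans hw
  have u1 : |Y w 2 - Y z 2| ≤ |(L h) 2| + |r 2| := by rw [e1]; exact abs_add_le _ _
  have u2 : ‖proj₀ (L h)‖ ≤ ‖proj₀ (Y w) - proj₀ (Y z)‖ + ‖proj₀ r‖ := by
    have : proj₀ (L h) = (proj₀ (Y w) - proj₀ (Y z)) - proj₀ r := by rw [e2]; ring
    rw [this]; exact norm_sub_le _ _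
  have u3 : ‖proj₀ (Y w) - proj₀ (Y z)‖ ≤ (C + c / 4) * ‖h‖ := by
    rw [e2]
    refine (norm_add_le _ _).trans ?_
    linarith [hLC h]
  have u4 : (c / 2) / (C + c / 4) * ‖proj₀ (Y w) - proj₀ (Y z)‖ ≤ (c / 2) * ‖h‖ := by
    rw [div_mul_eq_mul_div, div_le_iff₀ (by positivity)]
    nlinarith
  have := hlin h
  linarith

end LocalGraph

/-! ### Passage to the Riemann surface -/

section Charts

variable {R : Type*} [TopologicalSpace R] [ChartedSpace ℂ R]

theorem PiecewiseC1.continuous {c : ℝ → R} (hc : PiecewiseC1 c) : Continuous c := by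
  rw [continuous_iff_continuousAt]
  intro t
  obtain ⟨ε, hε, h1, h2⟩ := hc t
  rw [continuousAt_iff_continuous_left_right]
  constructor
  · refine (h1.continuousOn t (right_mem_Icc.2 (by linarith))).mono_of_mem_nhdsWithin ?_
    exact Icc_mem_nhdsLE (by linarith)
  · refine (h2.continuousOn t (left_mem_Icc.2 (by linarith))).mono_of_mem_nhdsWithin ?_
    exact Icc_mem_nhdsGE (by linarith)

theorem IsSimpleLoop.isCompact {Γ : Set R} (h : IsSimpleLoop Γ) : IsCompact Γ := by
  obtain ⟨c, hc, hp, -, rfl⟩ := h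
  rw [← hp.image_Icc zero_lt_one 0]
  exact isCompact_Icc.image hc.continuous

variable (M : BorderedSurface R)

theorem BorderedSurface.isClosed_boundary [T2Space R] : IsClosed M.boundary := by
  obtain ⟨𝒞, -, hlf, hU, hΓ⟩ := M.boundary_curves
  rw [← hU, sUnion_eq_iUnion]
  refine hlf.isClosed_iUnion fun Γ => ?_
  rcases hΓ Γ Γ.2 with ⟨p, hp⟩ | ⟨h | ⟨c, -, hc, hr⟩, -⟩
  · rw [hp]; exact isClosed_singleton
  · exact h.isCompact.isClosed
  · rw [← hr]; exact hc.isClosed_range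

theorem BorderedSurface.isOpen_int [T2Space R] : IsOpen M.int := by
  have : M.int = interior M.carrier \ M.boundary := by
    refine Subset.antisymm (fun p hp => ⟨?_, hp.2⟩) (sdiff_subset_sdiff_left interior_subset)
    by_contra hint
    exact hp.2 (M.frontier_subset ⟨subset_closure hp.1, hint⟩)
  rw [this]
  exact isOpen_interior.sdiff M.isClosed_boundary

theorem contDiffAt_comp_chartAt_symm {X : R → E3} (hX : ContMDiff 𝓘(ℝ, ℂ) 𝓘(ℝ, E3) ∞ X) (p : R) :
    ContDiffAt ℝ 2 (X ∘ (chartAt ℂ p).symm) (chartAt ℂ p p) := by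
  have h := (contMDiffAt_iff.1 (hX p)).2
  simp only [mfld_simps, contDiffWithinAt_univ] at h
  exact h.of_le ENat.LEInfty.out

theorem eventually_chartAt_symm_mem {U : Set R} (hU : IsOpen U) {p : R} (hp : p ∈ U) :
    ∀ᶠ w in 𝓝 (chartAt ℂ p p), w ∈ (chartAt ℂ p).target ∧ (chartAt ℂ p).symm w ∈ U := by
  have h1 := (chartAt ℂ p).open_target.mem_nhds (mem_chart_target ℂ p)
  have h2 : ContinuousAt (chartAt ℂ p).symm (chartAt ℂ p p) :=
    (chartAt ℂ p).continuousAt_symm (mem_chart_target ℂ p)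
  have h3 : U ∈ 𝓝 ((chartAt ℂ p).symm (chartAt ℂ p p)) := by
    rw [(chartAt ℂ p).left_inv (mem_chart_source ℂ p)]; exact hU.mem_nhds hp
  filter_upwards [h1, h2 h3] with w hw1 hw2 using ⟨hw1, hw2⟩

variable {M} {X : R → E3}

theorem IsConformalMaximalImmersion.eventually_height [T2Space R]
    (hX : IsConformalMaximalImmersion M X) {p : R} (hp : p ∈ M.int) :
    ∃ κ < (1 : ℝ), ∀ᶠ ζ in 𝓝 (proj₀ (X p)), ∃ q ∈ M.int, proj₀ (X q) = ζ ∧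
      |X q 2 - X p 2| ≤ κ * ‖ζ - proj₀ (X p)‖ := by
  have hY := contDiffAt_comp_chartAt_symm hX.smooth p
  have hz := mem_chart_target ℂ p
  have hl : (chartAt ℂ p).symm (chartAt ℂ p p) = p := (chartAt ℂ p).left_inv (mem_chart_source ℂ p)
  have hsp := hX.spacelike _ (chart_mem_atlas ℂ p) _ hz (by rwa [hl])
  have hiso := hX.conformal _ (chart_mem_atlas ℂ p) _ hz (by rwa [hl])
  obtain ⟨κ, hκ, hev⟩ := eventually_abs_height_sub_le hY hiso hsp
  refine ⟨κ, hκ, ?_⟩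
  have hmap := map_nhds_proj₀_comp hY hsp
  simp only [Function.comp_apply, hl] at hmap hev
  rw [← hmap, eventually_map]
  filter_upwards [hev, eventually_chartAt_symm_mem M.isOpen_int hp] with w hw hw2
  exact ⟨_, hw2.2, rfl, hw⟩

theorem IsConformalMaximalImmersion.not_isLocalMax [T2Space R]
    (hX : IsConformalMaximalImmersion M X) {p : R} (hp : p ∈ M.int) (x₀ : E3) {f : R → ℝ}
    (hf : HarmonicOnSurface f M.int) {φ φ' : ℝ → ℝ} {φ2 : ℝ}
    (hφ : ∀ᶠ t in 𝓝 (lorentz (X p - x₀) (X p - x₀)), HasDerivAt φ (φ' t) t)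
    (hφ' : HasDerivAt φ' φ2 (lorentz (X p - x₀) (X p - x₀)))
    (hφ2 : φ2 ≤ 0)
    (hlt : φ' (lorentz (X p - x₀) (X p - x₀)) + lorentz (X p - x₀) (X p - x₀) * φ2 < 0) :
    ¬ IsLocalMax (fun q => f q - φ (lorentz (X q - x₀) (X q - x₀))) p := by
  intro hmax
  have hY := contDiffAt_comp_chartAt_symm hX.smooth p
  have hz := mem_chart_target ℂ p
  have hl : (chartAt ℂ p).symm (chartAt ℂ p p) = p := (chartAt ℂ p).left_inv (mem_chart_source ℂ p)
  have hsp := hX.spacelike _ (chart_mem_atlas ℂ p) _ hz (by rwa [hl])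
  have hm := hX.maximal _ (chart_mem_atlas ℂ p) _ hz (by rwa [hl])
  have hiso : ∀ᶠ w in 𝓝 (chartAt ℂ p p), IsothermalAt (X ∘ (chartAt ℂ p).symm) w :=
    (eventually_chartAt_symm_mem M.isOpen_int hp).mono fun w hw =>
      hX.conformal _ (chart_mem_atlas ℂ p) _ hw.1 hw.2
  have hlap := laplacian_eq_zero hY hiso hsp hm
  have hh := hf _ (chart_mem_atlas ℂ p) _ ⟨hz, by rwa [mem_preimage, hl]⟩
  refine not_isLocalMax_sub_comp_lorentz hY hiso.self_of_nhds hsp hlap x₀ hh (φ := φ) (φ' := φ')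
    (φ2 := φ2) (by simpa [hl] using hφ) (by simpa [hl] using hφ') hφ2 (by simpa [hl] using hlt) ?_
  have hc : ContinuousAt (chartAt ℂ p).symm (chartAt ℂ p p) :=
    (chartAt ℂ p).continuousAt_symm (mem_chart_target ℂ p)
  rw [ContinuousAt, hl] at hc
  filter_upwards [hc.eventually hmax] with w hw
  simpa [hl] using hw

/-- The strong maximum principle for harmonic functions in the plane. -/
theorem eventually_eq_of_isLocalMax_harmonic {h : ℂ → ℝ} {z : ℂ}
    (hh : ∀ᶠ w in 𝓝 z, InnerProductSpace.HarmonicAt h w) (hmax : IsLocalMax h z) :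
    ∀ᶠ w in 𝓝 z, h w = h z := by
  obtain ⟨r, hr, hball⟩ := Metric.eventually_nhds_iff_ball.1 hh
  obtain ⟨F, hF, hre⟩ :=
    InnerProductSpace.HarmonicOnNhd.exists_analyticOnNhd_ball_re_eq (f := h) (z := z) (R := r) hball
  have hb := Metric.ball_mem_nhds z hr
  -- Exponentiating a holomorphic `F` with real part `h` reduces the claim to the maximum modulus
  -- principle.
  have hn : ∀ w ∈ Metric.ball z r, ‖exp (F w)‖ = Real.exp (h w) := fun w hw => by
    rw [Complex.norm_exp]; congr 1; exact hre hw
  have hz := Metric.mem_ball_self (x := z) hr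
  have hm : IsLocalMax (norm ∘ fun w => exp (F w)) z := by
    filter_upwards [hmax, hb] with w h1 h2
    simp only [Function.comp_apply, hn w h2, hn z hz]
    exact Real.exp_le_exp.2 h1
  have hd : ∀ᶠ w in 𝓝 z, DifferentiableAt ℂ (fun w => exp (F w)) w := by
    filter_upwards [hb] with w hw
    exact (hF w hw).differentiableAt.cexp
  have := Complex.norm_eventually_eq_of_isLocalMax hd hm
  filter_upwards [this, hb] with w h1 h2
  rw [hn w h2, hn z hz] at h1
  exact Real.exp_injective h1

theorem HarmonicOnSurface.eventually_eq {f : R → ℝ} {U : Set R} (hU : IsOpen U)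
    (hf : HarmonicOnSurface f U) {p : R} (hp : p ∈ U) (hmax : IsLocalMax f p) :
    ∀ᶠ q in 𝓝 p, f q = f p := by
  have hl : (chartAt ℂ p).symm (chartAt ℂ p p) = p := (chartAt ℂ p).left_inv (mem_chart_source ℂ p)
  have hc : ContinuousAt (chartAt ℂ p).symm (chartAt ℂ p p) :=
    (chartAt ℂ p).continuousAt_symm (mem_chart_target ℂ p)
  rw [ContinuousAt, hl] at hc
  have h1 : ∀ᶠ w in 𝓝 (chartAt ℂ p p), InnerProductSpace.HarmonicAt (f ∘ (chartAt ℂ p).symm) w :=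
    (eventually_chartAt_symm_mem hU hp).mono fun w hw => hf _ (chart_mem_atlas ℂ p) w hw
  have h2 : IsLocalMax (f ∘ (chartAt ℂ p).symm) (chartAt ℂ p p) := by
    filter_upwards [hc.eventually hmax] with w hw
    simpa [hl] using hw
  have h3 := eventually_eq_of_isLocalMax_harmonic h1 h2
  have hcp : ContinuousAt (chartAt ℂ p) p := (chartAt ℂ p).continuousAt (mem_chart_source ℂ p)
  filter_upwards [hcp.eventually h3, (chartAt ℂ p).open_source.mem_nhds (mem_chart_source ℂ p)]
    with q hq hqs
  simpa [hl, (chartAt ℂ p).left_inv hqs] using hq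

theorem HarmonicOnSurface.neg {f : R → ℝ} {U : Set R} (hf : HarmonicOnSurface f U) :
    HarmonicOnSurface (-f) U := fun e he z hz =>
  (hf e he z hz).neg

end Charts

end MaximalSurface

namespace MaximalSurface

open Set Filter Topology Complex MeasureTheory

/-! ### Almost every ray meets a small set negligibly -/

section Rays

/-- Almost every ray of a sector meets (the projection of) a set of dimension at most one in such
a way that the values of `x₃ + s r` on the intersection form a null set. -/
theorem ae_ray_null {A : Set E3} (hA : dimH A ≤ 1) (z₀ : ℂ) {ζ : ℂ} (hζ : ζ ≠ 0) (s : ℝ) :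
    ∀ᵐ σ : ℝ, volume {y : ℝ | ∃ x ∈ A, ∃ r : ℝ, 0 < r ∧ proj₀ x - z₀ = r • ((1 + σ * I) * ζ) ∧
      y = x 2 + s * ‖proj₀ x - z₀‖} = 0 := by
  set w : E3 → ℂ := fun x => (proj₀ x - z₀) / ζ with hw
  -- Slope of the ray, paired with the quantity to be shown null. `Φ` is locally Lipschitz where the
  -- slope is defined, so the image has dimension below two and is null in the plane; Fubini gives
  -- null slices.
  set Φ : E3 → ℝ × ℝ := fun x => ((w x).im / (w x).re, x 2 + s * ‖proj₀ x - z₀‖) with hΦ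
  have hproj : ContDiff ℝ 1 proj₀ := projL.contDiff
  have hwc : ContDiff ℝ 1 w := (hproj.sub contDiff_const).div_const ζ
  have hlip : ∀ x ∈ A ∩ {x | 0 < (w x).re}, ∃ C : NNReal, ∃ t ∈ 𝓝[A ∩ {x | 0 < (w x).re}] x,
      LipschitzOnWith C Φ t := by
    rintro x ⟨-, hx⟩
    have hre : ContDiffAt ℝ 1 (fun x => (w x).re) x := (reCLM.contDiff.comp hwc).contDiffAt
    have him : ContDiffAt ℝ 1 (fun x => (w x).im) x := (imCLM.contDiff.comp hwc).contDiffAt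
    have hne : proj₀ x - z₀ ≠ 0 := by
      intro h0
      have hx' : 0 < (w x).re := hx
      simp [hw, h0] at hx'
    have hn : ContDiffAt ℝ 1 (fun x => ‖proj₀ x - z₀‖) x :=
      (hproj.sub contDiff_const).contDiffAt.norm ℝ hne
    have h2 : ContDiffAt ℝ 1 (fun x : E3 => x 2) x :=
      (EuclideanSpace.proj (𝕜 := ℝ) (2 : Fin 3)).contDiff.contDiffAt
    have hd : ContDiffAt ℝ 1 Φ x :=
      (him.div hre (ne_of_gt hx)).prodMk (h2.add (contDiffAt_const.mul hn))
    obtain ⟨K, t, ht, hK⟩ := hd.exists_lipschitzOnWith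
    exact ⟨K, t, mem_nhdsWithin_of_mem_nhds ht, hK⟩
  have hdim : dimH (Φ '' (A ∩ {x | 0 < (w x).re})) < (2 : NNReal) :=
    ((dimH_image_le_of_locally_lipschitzOn hlip).trans ((dimH_mono inter_subset_left).trans
      hA)).trans_lt (by norm_num)
  have hnull : (volume : Measure (ℝ × ℝ)) (Φ '' (A ∩ {x | 0 < (w x).re})) = 0 := by
    rw [← hausdorffMeasure_prod_real]
    exact_mod_cast hausdorffMeasure_of_dimH_lt hdim
  filter_upwards [Measure.measure_ae_null_of_prod_null hnull] with σ hσ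
  refine measure_mono_null ?_ hσ
  rintro y ⟨x, hx, r, hr, hxr, rfl⟩
  have hwx : w x = r + (r * σ : ℝ) * I := by
    simp only [hw, hxr, real_smul]
    field_simp
    push_cast
    ring
  have hre : (w x).re = r := by rw [hwx]; simp
  have him : (w x).im = r * σ := by rw [hwx]; simp
  refine ⟨x, ⟨hx, by rw [mem_ofPred_eq, hre]; exact hr⟩, ?_⟩
  simp only [hΦ, hre, him]
  rw [mul_div_cancel_left₀ _ hr.ne']

end Rays

/-! ### Dimension of the image of the boundary -/

section Boundary

variable {R : Type*} [TopologicalSpace R] [ChartedSpace ℂ R] {M : BorderedSurface R} {X : R → E3}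

theorem isCompact_inter_preimage (hproper : IsProperMap (M.carrier.domRestrict X)) {K : Set E3}
    (hK : IsCompact K) : IsCompact (M.carrier ∩ X ⁻¹' K) := by
  convert (hproper.isCompact_preimage hK).image continuous_subtype_val using 1
  ext p
  constructor
  · rintro ⟨h1, h2⟩
    exact ⟨⟨p, h1⟩, h2, rfl⟩
  · rintro ⟨⟨q, hq⟩, h2, rfl⟩
    exact ⟨hq, h2⟩

theorem lipschitzOnWith_union_Icc {V : Type*} [PseudoEMetricSpace V] {f : ℝ → V} {a t b : ℝ}
    {K : NNReal} (h1 : LipschitzOnWith K f (Icc a t)) (h2 : LipschitzOnWith K f (Icc t b)) :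
    LipschitzOnWith K f (Icc a b) := by
  have key : ∀ x ∈ Icc a b, ∀ y ∈ Icc a b, x ≤ y → edist (f x) (f y) ≤ K * edist x y := by
    intro x hx y hy hxy
    rcases le_total y t with hyt | hty
    · exact h1 ⟨hx.1, hxy.trans hyt⟩ ⟨hy.1, hyt⟩
    rcases le_total t x with htx | hxt
    · exact h2 ⟨htx, hx.2⟩ ⟨hty, hy.2⟩
    calc edist (f x) (f y) ≤ edist (f x) (f t) + edist (f t) (f y) := edist_triangle _ _ _
      _ ≤ K * edist x t + K * edist t y :=
        add_le_add (h1 ⟨hx.1, hxt⟩ ⟨hx.1.trans hxt, le_rfl⟩) (h2 ⟨le_rfl, hty.trans hy.2⟩ ⟨hty, hy.2⟩)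
      _ = K * edist x y := by
        rw [← mul_add, edist_dist, edist_dist, edist_dist, ← ENNReal.ofReal_add dist_nonneg
          dist_nonneg, Real.dist_eq, Real.dist_eq, Real.dist_eq, abs_of_nonpos (by linarith),
          abs_of_nonpos (by linarith), abs_of_nonpos (by linarith)]
        ring_nf
  intro x hx y hy
  rcases le_total x y with h | h
  · exact key x hx y hy h
  · rw [edist_comm, edist_comm x]
    exact key y hy x hx h

theorem PiecewiseC1.dimH_image_range_le (hX : ContMDiff 𝓘(ℝ, ℂ) 𝓘(ℝ, E3) ∞ X) {c : ℝ → R}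
    (hc : PiecewiseC1 c) : dimH (X '' range c) ≤ 1 := by
  have hX1 : ContMDiff 𝓘(ℝ, ℂ) 𝓘(ℝ, E3) 1 X :=
    hX.of_le ENat.LEInfty.out
  rw [← range_comp, ← image_univ]
  have hdim : dimH (univ : Set ℝ) = 1 := Real.dimH_univ
  rw [← hdim]
  refine dimH_image_le_of_locally_lipschitzOn fun t _ => ?_
  obtain ⟨ε, hε, h1, h2⟩ := hc t
  have h1' : ContDiffOn ℝ 1 (X ∘ c) (Icc (t - ε) t) :=
    contMDiffOn_iff_contDiffOn.1 (hX1.comp_contMDiffOn h1)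
  have h2' : ContDiffOn ℝ 1 (X ∘ c) (Icc t (t + ε)) :=
    contMDiffOn_iff_contDiffOn.1 (hX1.comp_contMDiffOn h2)
  obtain ⟨K1, s1, hs1, hK1⟩ :=
    (h1' t (right_mem_Icc.2 (by linarith))).exists_lipschitzOnWith (convex_Icc _ _)
  obtain ⟨K2, s2, hs2, hK2⟩ :=
    (h2' t (left_mem_Icc.2 (by linarith))).exists_lipschitzOnWith (convex_Icc _ _)
  rw [nhdsWithin_Icc_eq_nhdsLE (by linarith)] at hs1
  rw [nhdsWithin_Icc_eq_nhdsGE (by linarith)] at hs2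
  obtain ⟨a, ha, has⟩ := (mem_nhdsLE_iff_exists_Icc_subset).1 hs1
  obtain ⟨b, hb, hbs⟩ := (mem_nhdsGE_iff_exists_Icc_subset).1 hs2
  refine ⟨max K1 K2, Icc a b, ?_, lipschitzOnWith_union_Icc
    ((hK1.mono has).weaken (le_max_left _ _)) ((hK2.mono hbs).weaken (le_max_right _ _))⟩
  rw [nhdsWithin_univ]
  exact Icc_mem_nhds ha hb

/-- By properness each ball of `ℝ³` involves only finitely many boundary members, so there are
countably many, each a point or a locally Lipschitz image of a line. -/
theorem dimH_image_boundary_le (hX : ContMDiff 𝓘(ℝ, ℂ) 𝓘(ℝ, E3) ∞ X)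
    (hproper : IsProperMap (M.carrier.domRestrict X)) : dimH (X '' M.boundary) ≤ 1 := by
  obtain ⟨𝒞, -, hlf, hU, hΓ⟩ := M.boundary_curves
  have hne : ∀ Γ ∈ 𝒞, Γ.Nonempty := by
    intro Γ h
    rcases hΓ Γ h with ⟨p, rfl⟩ | ⟨⟨c, -, -, -, rfl⟩ | ⟨c, -, -, rfl⟩, -⟩
    · exact singleton_nonempty p
    · exact range_nonempty c
    · exact range_nonempty c
  have hcount : Countable 𝒞 := by
    rw [← countable_univ_iff]
    refine (countable_iUnion fun n : ℕ => (hlf.finite_nonempty_inter_compact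
      (isCompact_inter_preimage hproper (isCompact_closedBall (0 : E3) n))).countable).mono ?_
    intro Γ _
    obtain ⟨p, hp⟩ := hne Γ Γ.2
    obtain ⟨n, hn⟩ := exists_nat_ge ‖X p‖
    refine mem_iUnion.2 ⟨n, p, hp, M.boundary_subset (hU ▸ mem_sUnion_of_mem hp Γ.2), ?_⟩
    simpa using hn
  rw [← hU, sUnion_eq_iUnion, image_iUnion, dimH_iUnion]
  refine iSup_le fun Γ => ?_
  rcases hΓ Γ Γ.2 with ⟨p, hp⟩ | ⟨⟨c, hc, -, -, hr⟩ | ⟨c, hc, -, hr⟩, -⟩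
  · rw [hp, image_singleton, dimH_singleton]; exact zero_le_one
  · rw [← hr]; exact hc.dimH_image_range_le hX
  · rw [← hr]; exact hc.dimH_image_range_le hX

end Boundary

/-! ### The height function along rays -/

section Starlike

variable {R : Type*} [TopologicalSpace R] [ChartedSpace ℂ R] {M : BorderedSurface R}
  {X : R → E3} {Ω : Set ℂ} {u : ℂ → ℝ}

/-- The point of `ℝ³` over `ζ` at height `y`. -/
noncomputable def lift (ζ : ℂ) (y : ℝ) : E3 := !₂[ζ.re, ζ.im, y]

@[simp] theorem proj₀_lift (ζ : ℂ) (y : ℝ) : proj₀ (lift ζ y) = ζ := by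
  apply Complex.ext <;> simp [proj₀, lift]

@[simp] theorem lift_two (ζ : ℂ) (y : ℝ) : lift ζ y 2 = y := by simp [lift]

theorem continuous_lift : Continuous fun q : ℂ × ℝ => lift q.1 q.2 := by
  unfold lift
  refine (PiLp.continuous_toLp 2 _).comp (continuous_pi fun i => ?_)
  fin_cases i
  · exact continuous_re.comp continuous_fst
  · exact continuous_im.comp continuous_fst
  · exact continuous_snd

theorem lift_mem_iff (hu : X '' M.carrier = {x : E3 | proj₀ x ∈ Ω ∧ x 2 = u (proj₀ x)}) {ζ : ℂ}
    {y : ℝ} : lift ζ y ∈ X '' M.carrier ↔ ζ ∈ Ω ∧ y = u ζ := by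
  rw [hu]; simp

theorem graph_apply (hu : X '' M.carrier = {x : E3 | proj₀ x ∈ Ω ∧ x 2 = u (proj₀ x)}) {p : R}
    (hp : p ∈ M.carrier) : proj₀ (X p) ∈ Ω ∧ X p 2 = u (proj₀ (X p)) := by
  have : X p ∈ X '' M.carrier := mem_image_of_mem X hp
  rwa [hu] at this

/-- The height function of a maximal graph is locally a strict contraction at interior points. -/
theorem IsConformalMaximalImmersion.eventually_graph [T2Space R]
    (hX : IsConformalMaximalImmersion M X)
    (hu : X '' M.carrier = {x : E3 | proj₀ x ∈ Ω ∧ x 2 = u (proj₀ x)}) {p : R} (hp : p ∈ M.int) :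
    ∃ κ < (1 : ℝ), ∀ᶠ ζ in 𝓝 (proj₀ (X p)), ζ ∈ Ω ∧
      |u ζ - u (proj₀ (X p))| ≤ κ * ‖ζ - proj₀ (X p)‖ := by
  obtain ⟨κ, hκ, hev⟩ := hX.eventually_height hp
  refine ⟨κ, hκ, hev.mono ?_⟩
  rintro ζ ⟨q, hq, rfl, hle⟩
  have h1 := graph_apply hu hq.1
  rw [h1.2, (graph_apply hu hp.1).2] at hle
  exact ⟨h1.1, hle⟩

/-- The exceptional parameters are those with no interior point above them; the graph there comes
from the boundary, so `hnull` applies with both signs. -/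
theorem contractingOffNull_ray [T2Space R]
    (hX : IsConformalMaximalImmersion M X)
    (hu : X '' M.carrier = {x : E3 | proj₀ x ∈ Ω ∧ x 2 = u (proj₀ x)}) {z₀ e : ℂ} (he : ‖e‖ = 1)
    {a b : ℝ} (ha : 0 < a) (hseg : ∀ r ∈ Icc a b, z₀ + r • e ∈ Ω)
    (hnull : ∀ s : ℝ, |s| = 1 → volume {y : ℝ | ∃ x ∈ X '' M.boundary, ∃ r : ℝ, 0 < r ∧
      proj₀ x - z₀ = r • e ∧ y = x 2 + s * ‖proj₀ x - z₀‖} = 0) :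
    ContractingOffNull (fun r => u (z₀ + r • e)) a b
      {r | r ∈ Icc a b ∧ ∀ p ∈ M.int, proj₀ (X p) ≠ z₀ + r • e} := by
  have key : ∀ s : ℝ, |s| = 1 → volume ((fun r : ℝ => u (z₀ + r • e) + s * r) ''
      {r | r ∈ Icc a b ∧ ∀ p ∈ M.int, proj₀ (X p) ≠ z₀ + r • e}) = 0 := by
    intro s hs
    refine measure_mono_null ?_ (hnull s hs)
    rintro _ ⟨r, ⟨hr, hp⟩, rfl⟩
    have hr0 : 0 < r := ha.trans_le hr.1
    obtain ⟨p, hpM, hpx⟩ := (lift_mem_iff hu).2 ⟨hseg r hr, rfl⟩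
    have hproj : proj₀ (X p) = z₀ + r • e := by rw [hpx, proj₀_lift]
    have hb : p ∈ M.boundary := by
      by_contra hb
      exact hp p ⟨hpM, hb⟩ hproj
    refine ⟨X p, mem_image_of_mem X hb, r, hr0, by rw [hproj]; ring, ?_⟩
    rw [hproj, hpx, lift_two, add_sub_cancel_left, norm_smul, he, Real.norm_eq_abs,
      abs_of_pos hr0, mul_one]
  refine ⟨fun r hr hrS => ?_, ?_, ?_⟩
  · obtain ⟨p, hp, hpr⟩ : ∃ p ∈ M.int, proj₀ (X p) = z₀ + r • e := by
      by_contra! hc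
      exact hrS ⟨hr, hc⟩
    obtain ⟨κ, hκ, hev⟩ := hX.eventually_graph hu hp
    rw [hpr] at hev
    have hc : Continuous fun r : ℝ => z₀ + r • e := by fun_prop
    refine ⟨κ, hκ, (hc.continuousAt.eventually hev).mono fun s hs => ?_⟩
    have : z₀ + s • e - (z₀ + r • e) = (s - r) • e := by rw [sub_smul]; ring
    have h2 := hs.2
    rwa [this, norm_smul, he, mul_one] at h2
  · simpa [sub_eq_add_neg] using key (-1) (by simp)
  · simpa using key 1 (by simp)

theorem closedGraphOn_ray (hclosed : IsClosed (X '' M.carrier))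
    (hu : X '' M.carrier = {x : E3 | proj₀ x ∈ Ω ∧ x 2 = u (proj₀ x)}) {z₀ e : ℂ} {a b : ℝ}
    (hseg : ∀ r ∈ Icc a b, z₀ + r • e ∈ Ω) :
    ClosedGraphOn (fun r => u (z₀ + r • e)) a b := by
  have hc : Continuous fun q : ℝ × ℝ => lift (z₀ + q.1 • e) q.2 :=
    continuous_lift.comp (f := fun q : ℝ × ℝ => (z₀ + q.1 • e, q.2)) (by fun_prop)
  have h1 : IsClosed {q : ℝ × ℝ | q.1 ∈ Icc a b} := isClosed_Icc.preimage continuous_fst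
  rw [ClosedGraphOn]
  convert h1.inter (hclosed.preimage hc) using 1
  ext q
  simp only [mem_ofPred_eq, mem_inter_iff, mem_preimage, lift_mem_iff hu]
  exact and_congr_right fun h => ⟨fun h2 => ⟨hseg _ h, h2⟩, fun h2 => h2.2⟩

/-- Along almost every ray of a starlike domain, and hence along every ray, the height function
of a maximal graph is `1`-Lipschitz. -/
theorem abs_height_sub_le_of_starConvex [T2Space R]
    (hX : IsConformalMaximalImmersion M X)
    (hproper : IsProperMap (M.carrier.domRestrict X))
    (hu : X '' M.carrier = {x : E3 | proj₀ x ∈ Ω ∧ x 2 = u (proj₀ x)}) {z₀ : ℂ}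
    (hstar : StarConvex ℝ z₀ Ω) {r₀ c : ℝ} (hr₀ : 0 < r₀)
    (hsphere : ∀ ξ, ‖ξ - z₀‖ = r₀ → |u ξ - u z₀| ≤ c) {p : R} (hp : p ∈ M.int)
    (hpr : r₀ < ‖proj₀ (X p) - z₀‖) :
    |X p 2 - u z₀| ≤ ‖proj₀ (X p) - z₀‖ - r₀ + c := by
  have hclosed : IsClosed (X '' M.carrier) := by
    have := hproper.isClosedMap.isClosed_range
    rwa [Set.range_domRestrict] at this
  set ζ := proj₀ (X p) - z₀ with hζ
  have hζ0 : ζ ≠ 0 := norm_pos_iff.1 (hr₀.trans hpr)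
  have hdim := dimH_image_boundary_le hX.smooth hproper
  -- A transversal family of endpoints through `proj₀ (X p)`, attained at `σ = 0`; the estimate is
  -- proved for almost every `σ`.
  set v : ℝ → ℂ := fun σ => (1 + σ * I) * ζ with hv
  have hvc : Continuous v := by fun_prop
  have hv0 : v 0 = ζ := by simp [hv]
  have hend0 : z₀ + v 0 = proj₀ (X p) := by rw [hv0, hζ]; ring
  obtain ⟨κ, -, hev⟩ := hX.eventually_graph hu hp
  have hend : ContinuousAt (fun σ => z₀ + v σ) 0 := by fun_prop
  rw [← hend0] at hev
  have hucont : ContinuousAt (fun σ => u (z₀ + v σ)) 0 := by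
    have hlim : Tendsto (fun ξ => κ * ‖ξ - (z₀ + v 0)‖) (𝓝 (z₀ + v 0)) (𝓝 0) := by
      have : Continuous fun ξ => κ * ‖ξ - (z₀ + v 0)‖ := by fun_prop
      simpa using this.tendsto (z₀ + v 0)
    have huc : ContinuousAt u (z₀ + v 0) := by
      rw [ContinuousAt, tendsto_iff_norm_sub_tendsto_zero]
      exact squeeze_zero' (Eventually.of_forall fun _ => norm_nonneg _)
        (hev.mono fun ξ h => h.2) hlim
    exact ContinuousAt.comp (f := fun σ => z₀ + v σ) huc hend
  have hgood : ∀ᵐ σ : ℝ, z₀ + v σ ∈ Ω → r₀ ≤ ‖v σ‖ →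
      |u (z₀ + v σ) - u z₀| ≤ ‖v σ‖ - r₀ + c := by
    filter_upwards [ae_ray_null hdim z₀ hζ0 1, ae_ray_null hdim z₀ hζ0 (-1)] with σ h1 h2 hΩ hle
    set ℓ := ‖v σ‖
    have hℓ : 0 < ℓ := hr₀.trans_le hle
    set e : ℂ := ℓ⁻¹ • v σ with he
    have he1 : ‖e‖ = 1 := by
      rw [he, norm_smul, norm_inv, Real.norm_eq_abs, abs_of_pos hℓ, inv_mul_cancel₀ hℓ.ne']
    have hℓe : ℓ • e = v σ := by rw [he, smul_smul, mul_inv_cancel₀ hℓ.ne', one_smul]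
    have hseg : ∀ r ∈ Icc r₀ ℓ, z₀ + r • e ∈ Ω := by
      intro r hr
      have := hstar.add_smul_mem hΩ (t := r * ℓ⁻¹)
        (mul_nonneg (hr₀.le.trans hr.1) (inv_nonneg.2 hℓ.le))
        (by rw [← div_eq_mul_inv]; exact (div_le_one hℓ).2 hr.2)
      rwa [mul_smul] at this
    have hnull : ∀ s : ℝ, |s| = 1 → volume {y : ℝ | ∃ x ∈ X '' M.boundary, ∃ r : ℝ, 0 < r ∧
        proj₀ x - z₀ = r • e ∧ y = x 2 + s * ‖proj₀ x - z₀‖} = 0 := by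
      intro s hs
      have hmono : ∀ y, (∃ x ∈ X '' M.boundary, ∃ r : ℝ, 0 < r ∧
          proj₀ x - z₀ = r • e ∧ y = x 2 + s * ‖proj₀ x - z₀‖) →
          ∃ x ∈ X '' M.boundary, ∃ r : ℝ, 0 < r ∧
          proj₀ x - z₀ = r • v σ ∧ y = x 2 + s * ‖proj₀ x - z₀‖ := by
        rintro y ⟨x, hx, r, hr, hxr, rfl⟩
        exact ⟨x, hx, r * ℓ⁻¹, by positivity, by rw [hxr, he, mul_smul], rfl⟩
      rcases eq_or_eq_neg_of_abs_eq hs with rfl | rfl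
      · exact measure_mono_null hmono h1
      · exact measure_mono_null hmono h2
    have h3 := (closedGraphOn_ray hclosed hu hseg).abs_sub_le
      (contractingOffNull_ray hX hu he1 hr₀ hseg hnull) hle
    simp only [hℓe] at h3
    have h4 := hsphere (z₀ + r₀ • e) (by
      rw [add_sub_cancel_left, norm_smul, he1, mul_one, Real.norm_eq_abs, abs_of_pos hr₀])
    have h5 := abs_sub_le (u (z₀ + v σ)) (u (z₀ + r₀ • e)) (u z₀)
    linarith
  rw [(graph_apply hu hp.1).2, ← hend0, ← hv0]
  -- As `u` is continuous under the interior point `p`, a strict violation at `σ = 0` would persist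
  -- nearby, where good `σ` are dense.
  by_contra! hlt
  have hcontL : ContinuousAt (fun σ => ‖v σ‖ - r₀ + c) 0 := by fun_prop
  have hcontR : ContinuousAt (fun σ => |u (z₀ + v σ) - u z₀|) 0 := (hucont.sub_const _).abs
  have hev1 := hcontL.eventually_lt hcontR hlt
  have hev2 : ∀ᶠ σ in 𝓝 (0 : ℝ), r₀ < ‖v σ‖ :=
    continuousAt_const.eventually_lt hvc.norm.continuousAt (by rwa [hv0])
  have hfreq : ∃ᶠ σ in 𝓝 (0 : ℝ), z₀ + v σ ∈ Ω → r₀ ≤ ‖v σ‖ →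
      |u (z₀ + v σ) - u z₀| ≤ ‖v σ‖ - r₀ + c :=
    mem_closure_iff_frequently.1 (Measure.dense_of_ae hgood 0)
  obtain ⟨σ, hσ, h1, h2, h3⟩ :=
    (hfreq.and_eventually (hev1.and (hev2.and (hend.eventually hev)))).exists
  linarith [hσ h3.1 h2.le]

end Starlike

end MaximalSurface

namespace MaximalSurface

open Set Filter Topology Complex

/-! ### The barrier -/

section Barrier

/-- The barrier `ε log (1 + log (t / c))`, which grows more slowly than the logarithm. -/
noncomputable def barrier (ε c t : ℝ) : ℝ := ε * Real.log (1 + (Real.log t - Real.log c))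

variable {ε c t : ℝ}

theorem one_le_one_add_log_sub (hc : 0 < c) (ht : c ≤ t) : 1 ≤ 1 + (Real.log t - Real.log c) := by
  linarith [Real.log_le_log hc ht]

theorem barrier_nonneg (hε : 0 ≤ ε) (hc : 0 < c) (ht : c ≤ t) : 0 ≤ barrier ε c t :=
  mul_nonneg hε (Real.log_nonneg (one_le_one_add_log_sub hc ht))

theorem tendsto_barrier (hε : 0 < ε) : Tendsto (barrier ε c) atTop atTop := by
  refine Tendsto.const_mul_atTop hε (Real.tendsto_log_atTop.comp ?_)
  exact tendsto_atTop_add_const_left _ _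
    (tendsto_atTop_add_const_right _ (-Real.log c) Real.tendsto_log_atTop)

theorem hasDerivAt_one_add_log_sub (ht : 0 < t) :
    HasDerivAt (fun t => 1 + (Real.log t - Real.log c)) t⁻¹ t :=
  ((Real.hasDerivAt_log ht.ne').sub_const _).const_add _

theorem hasDerivAt_barrier (hc : 0 < c) (ht : c ≤ t) :
    HasDerivAt (barrier ε c) (ε * (t * (1 + (Real.log t - Real.log c)))⁻¹) t := by
  have h1 := one_le_one_add_log_sub hc ht
  have h := ((hasDerivAt_one_add_log_sub (c := c) (hc.trans_le ht)).log (by linarith)).const_mul ε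
  refine h.congr_deriv ?_
  rw [mul_inv, div_eq_mul_inv]

theorem hasDerivAt_deriv_barrier (hc : 0 < c) (ht : c ≤ t) :
    HasDerivAt (fun t => ε * (t * (1 + (Real.log t - Real.log c)))⁻¹)
      (-(ε * (2 + (Real.log t - Real.log c)) / (t * (1 + (Real.log t - Real.log c))) ^ 2)) t := by
  have h1 := one_le_one_add_log_sub hc ht
  have ht0 := hc.trans_le ht
  have h := (((hasDerivAt_id t).mul (hasDerivAt_one_add_log_sub (c := c) ht0)).inv
    (mul_pos ht0 (by linarith)).ne').const_mul ε
  refine h.congr_deriv ?_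
  simp only [Pi.mul_apply, id]
  rw [mul_inv_cancel₀ ht0.ne']
  ring

/-- With `L = 1 + log (t / c)` the sum equals `-ε / (t L²)`. For the logarithm alone it would
vanish, which is why it is iterated. -/
theorem barrier_deriv_add_neg (hε : 0 < ε) (hc : 0 < c) (ht : c ≤ t) :
    ε * (t * (1 + (Real.log t - Real.log c)))⁻¹ +
      t * -(ε * (2 + (Real.log t - Real.log c)) /
        (t * (1 + (Real.log t - Real.log c))) ^ 2) < 0 := by
  have h1 := one_le_one_add_log_sub hc ht
  have ht0 := hc.trans_le ht
  set L := 1 + (Real.log t - Real.log c) with hL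
  have h2 : 2 + (Real.log t - Real.log c) = L + 1 := by rw [hL]; ring
  have hL0 : 0 < L := by linarith
  rw [h2]
  have : ε * (t * L)⁻¹ + t * -(ε * (L + 1) / (t * L) ^ 2) = -(ε / (t * L ^ 2)) := by
    field_simp
    ring
  rw [this]
  have : 0 < ε / (t * L ^ 2) := by positivity
  linarith

end Barrier

/-! ### Global maximum principle -/

section Parabolicity

variable {R : Type*} [TopologicalSpace R] [T2Space R] [ChartedSpace ℂ R] {M : BorderedSurface R}
  {X : R → E3}

theorem lorentz_sub_self (x y : E3) :
    lorentz (x - y) (x - y) = ‖proj₀ x - proj₀ y‖ ^ 2 - (x 2 - y 2) ^ 2 := by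
  rw [lorentz_self, proj₀_sub, PiLp.sub_apply]

/-- Maximum principle outside a compact set on which the Lorentzian norm need not be positive. -/
theorem le_of_le_on_compact (hX : IsConformalMaximalImmersion M X)
    (hproper : IsProperMap (M.carrier.domRestrict X)) {x₀ : E3} {r₀ δ : ℝ} (hδ : 0 < δ)
    (hδr : δ ≤ r₀)
    (hest : ∀ p ∈ M.carrier, r₀ ≤ ‖proj₀ (X p) - proj₀ x₀‖ →
      |X p 2 - x₀ 2| ≤ ‖proj₀ (X p) - proj₀ x₀‖ - δ)
    {f : R → ℝ} (hfc : ContinuousOn f M.carrier) (hfh : HarmonicOnSurface f M.int) {C m : ℝ}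
    (hC : ∀ p ∈ M.carrier, f p ≤ C) (h0 : ∀ p ∈ M.boundary, f p = 0) (hm : 0 ≤ m)
    (hK : ∀ p ∈ M.carrier, ‖proj₀ (X p) - proj₀ x₀‖ ≤ r₀ → f p ≤ m) {p : R}
    (hp : p ∈ M.carrier) : f p ≤ m := by
  by_contra! hlt
  set ψ : E3 → ℝ := fun x => lorentz (x - x₀) (x - x₀) with hψ
  have hψc : Continuous ψ := by simp only [hψ, lorentz]; fun_prop
  have hρc : Continuous fun x : E3 => ‖proj₀ x - proj₀ x₀‖ :=
    (continuous_proj₀.sub continuous_const).norm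
  have hXc : Continuous X := hX.smooth.continuous
  have hψge : ∀ x : E3, r₀ ≤ ‖proj₀ x - proj₀ x₀‖ → |x 2 - x₀ 2| ≤ ‖proj₀ x - proj₀ x₀‖ - δ →
      δ * ‖proj₀ x - proj₀ x₀‖ ≤ ψ x := by
    intro x h1 h2
    have h3 : (x 2 - x₀ 2) ^ 2 ≤ (‖proj₀ x - proj₀ x₀‖ - δ) ^ 2 := by
      rw [← sq_abs]; gcongr
    simp only [hψ, lorentz_sub_self]
    nlinarith
  set c := δ * r₀ with hcdef
  have hc : 0 < c := mul_pos hδ (hδ.trans_le hδr)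
  have hψc0 : ∀ q ∈ M.carrier, r₀ ≤ ‖proj₀ (X q) - proj₀ x₀‖ → c ≤ ψ (X q) := fun q hq hr =>
    le_trans (by rw [hcdef]; gcongr) (hψge _ hr (hest q hq hr))
  have hpr : r₀ ≤ ‖proj₀ (X p) - proj₀ x₀‖ := by
    by_contra! hc
    exact absurd (hK p hp hc.le) (not_le.2 hlt)
  have hb0 : 0 ≤ barrier 1 c (ψ (X p)) := barrier_nonneg zero_le_one hc (hψc0 p hp hpr)
  obtain ⟨ε, hε, hεp⟩ : ∃ ε > 0, m < f p - barrier ε c (ψ (X p)) := by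
    refine ⟨(f p - m) / (2 * (1 + barrier 1 c (ψ (X p)))), by
      have := sub_pos.2 hlt
      positivity, ?_⟩
    have h1 : barrier ((f p - m) / (2 * (1 + barrier 1 c (ψ (X p))))) c (ψ (X p)) =
        (f p - m) / (2 * (1 + barrier 1 c (ψ (X p)))) * barrier 1 c (ψ (X p)) := by
      simp [barrier]
    rw [h1, div_mul_eq_mul_div, lt_sub_iff_add_lt', ← lt_sub_iff_add_lt,
      div_lt_iff₀ (by positivity)]
    nlinarith
  obtain ⟨T, hTb, hTp⟩ := (((tendsto_barrier (c := c) hε).eventually_gt_atTop (C - m)).and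
    (eventually_gt_atTop (ψ (X p)))).exists
  -- The height condition holds on the whole image outside the disc. Imposing it on `B` makes `B`
  -- compact, since `ψ ≤ T` then bounds the radius by `T / δ`.
  set B : Set E3 := {x | r₀ ≤ ‖proj₀ x - proj₀ x₀‖ ∧ |x 2 - x₀ 2| ≤ ‖proj₀ x - proj₀ x₀‖ - δ ∧
    ψ x ≤ T}
  have hBc : IsClosed B := by
    refine (isClosed_le continuous_const hρc).inter
      ((isClosed_le ?_ (hρc.sub continuous_const)).inter (isClosed_le hψc continuous_const))
    fun_prop
  have hBK : IsCompact B := by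
    refine (isCompact_closedBall x₀ (2 * (T / δ))).of_isClosed_subset hBc fun x hx => ?_
    rw [mem_closedBall_iff_norm]
    have h1 : ‖proj₀ x - proj₀ x₀‖ ≤ T / δ := by
      rw [le_div_iff₀ hδ, mul_comm]
      exact (hψge x hx.1 hx.2.1).trans hx.2.2
    have h2 := hx.2.1
    have h3 : ‖x - x₀‖ ^ 2 ≤ (2 * (T / δ)) ^ 2 := by
      rw [norm_sq_eq, proj₀_sub, PiLp.sub_apply, ← sq_abs (x 2 - x₀ 2)]
      nlinarith [norm_nonneg (proj₀ x - proj₀ x₀), abs_nonneg (x 2 - x₀ 2)]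
    exact le_of_sq_le_sq h3 (by linarith [norm_nonneg (proj₀ x - proj₀ x₀)])
  have hN := isCompact_inter_preimage hproper hBK
  have hpN : p ∈ M.carrier ∩ X ⁻¹' B := ⟨hp, hpr, hest p hp hpr, hTp.le⟩
  have hgc : ContinuousOn (fun q => f q - barrier ε c (ψ (X q))) (M.carrier ∩ X ⁻¹' B) := by
    intro q hq
    have h1 : ContinuousAt (barrier ε c) (ψ (X q)) :=
      (hasDerivAt_barrier hc (hψc0 q hq.1 hq.2.1)).continuousAt
    have h2 : ContinuousAt (fun q => barrier ε c (ψ (X q))) q :=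
      ContinuousAt.comp (f := fun q => ψ (X q)) h1 (hψc.comp hXc).continuousAt
    exact ((hfc q hq.1).mono inter_subset_left).sub h2.continuousWithinAt
  obtain ⟨q, hq, hqmax⟩ := hN.exists_isMaxOn ⟨p, hpN⟩ hgc
  have hqm : m < f q - barrier ε c (ψ (X q)) := hεp.trans_le (hqmax hpN)
  have hqc := hψc0 q hq.1 hq.2.1
  have hqb := barrier_nonneg hε.le hc hqc
  have hqr : r₀ < ‖proj₀ (X q) - proj₀ x₀‖ := by
    refine lt_of_le_of_ne hq.2.1 fun heq => ?_
    linarith [hK q hq.1 heq.ge]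
  have hqT : ψ (X q) < T := by
    refine lt_of_le_of_ne hq.2.2.2 fun heq => ?_
    rw [heq] at hqm
    linarith [hC q hq.1]
  have hqI : q ∈ M.int := ⟨hq.1, fun hb => by linarith [h0 q hb]⟩
  have hcq : c < ψ (X q) := by
    refine lt_of_lt_of_le ?_ (hψge _ hq.2.1 hq.2.2.1)
    rw [hcdef]
    gcongr
  refine hX.not_isLocalMax hqI x₀ hfh (φ := barrier ε c)
    ((lt_mem_nhds hcq).mono fun t ht => hasDerivAt_barrier hc (le_of_lt ht))
    (hasDerivAt_deriv_barrier hc hqc) ?_ (barrier_deriv_add_neg hε hc hqc) ?_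
  · have h1 := one_le_one_add_log_sub hc hqc
    rw [Left.neg_nonpos_iff]
    have : 0 ≤ 2 + (Real.log (ψ (X q)) - Real.log c) := by linarith
    positivity
  · filter_upwards [M.isOpen_int.mem_nhds hqI,
      (hρc.comp hXc).continuousAt.eventually (lt_mem_nhds hqr),
      (hψc.comp hXc).continuousAt.eventually (gt_mem_nhds hqT)] with q' h1 h2 h3
    have h2' : r₀ ≤ ‖proj₀ (X q') - proj₀ x₀‖ := le_of_lt h2
    exact hqmax ⟨h1.1, h2', hest q' h1.1 h2', le_of_lt h3⟩

/-- The height of a maximal graph over a starlike domain stays at bounded distance inside the light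
cone. -/
theorem exists_height_estimate (hX : IsConformalMaximalImmersion M X)
    (hproper : IsProperMap (M.carrier.domRestrict X)) {Ω : Set ℂ}
    (hgraph : IsGraphOver (X '' M.carrier) Ω) {p₀ : R} (hp₀ : p₀ ∈ M.int)
    (hstar : StarConvex ℝ (proj₀ (X p₀)) Ω) :
    ∃ r₀ δ : ℝ, 0 < δ ∧ δ ≤ r₀ ∧
      (∀ p ∈ M.carrier, ‖proj₀ (X p) - proj₀ (X p₀)‖ ≤ r₀ → |X p 2 - X p₀ 2| ≤ r₀) ∧
      ∀ p ∈ M.carrier, r₀ ≤ ‖proj₀ (X p) - proj₀ (X p₀)‖ →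
        |X p 2 - X p₀ 2| ≤ ‖proj₀ (X p) - proj₀ (X p₀)‖ - δ := by
  obtain ⟨u, hu⟩ := hgraph
  obtain ⟨κ, hκ, hev⟩ := hX.eventually_graph hu hp₀
  obtain ⟨r₀, hr₀, hball⟩ := Metric.nhds_basis_closedBall.eventually_iff.1 hev
  set κ' := max κ 0
  have hκ' : κ' < 1 := max_lt hκ one_pos
  have hκ0 : 0 ≤ κ' := le_max_right _ _
  have hup₀ := (graph_apply hu hp₀.1).2
  have hin : ∀ ξ, ‖ξ - proj₀ (X p₀)‖ ≤ r₀ →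
      |u ξ - u (proj₀ (X p₀))| ≤ κ' * ‖ξ - proj₀ (X p₀)‖ := fun ξ hξ =>
    ((hball (mem_closedBall_iff_norm.2 hξ)).2).trans (by gcongr; exact le_max_left _ _)
  -- On the circle of radius `r₀` the height difference is at most `κ' r₀`; the deficit `(1 - κ')
  -- r₀` is kept along the rest of each ray.
  refine ⟨r₀, (1 - κ') * r₀, mul_pos (by linarith) hr₀, by nlinarith, fun p hp hpr => ?_,
    fun p hp hpr => ?_⟩
  · rw [(graph_apply hu hp).2, hup₀]
    refine (hin _ hpr).trans ?_
    nlinarith [norm_nonneg (proj₀ (X p) - proj₀ (X p₀))]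
  · rcases hpr.eq_or_lt with heq | hlt
    · rw [(graph_apply hu hp).2, hup₀]
      refine (hin _ heq.ge).trans (le_of_eq ?_)
      rw [← heq]; ring
    · have hXc : Continuous X := hX.smooth.continuous
      have hρc : Continuous fun q => ‖proj₀ (X q) - proj₀ (X p₀)‖ :=
        ((continuous_proj₀.comp hXc).sub continuous_const).norm
      have hcl : IsClosed {q | |X q 2 - X p₀ 2| ≤ ‖proj₀ (X q) - proj₀ (X p₀)‖ - (1 - κ') * r₀} := by
        refine isClosed_le ?_ (hρc.sub continuous_const)
        fun_prop
      -- The ray estimate is for interior points; density of the interior and closedness of the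
      -- inequality cover boundary points.
      have hmem : p ∈ closure ({q | r₀ < ‖proj₀ (X q) - proj₀ (X p₀)‖} ∩ M.int) :=
        (isOpen_lt continuous_const hρc).inter_closure ⟨hlt, M.interior_dense hp⟩
      refine hcl.closure_subset_iff.2 ?_ hmem
      rintro q ⟨hq, hqI⟩
      have := abs_height_sub_le_of_starConvex hX hproper hu hstar hr₀ (c := κ' * r₀)
        (fun ξ hξ => (hin ξ hξ.le).trans (by rw [hξ])) hqI hq
      rw [← hup₀] at this
      rw [mem_ofPred_eq]
      linarith

theorem nonpos_of_starConvex (hM : M.boundary.Nonempty) (hX : IsConformalMaximalImmersion M X)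
    (hproper : IsProperMap (M.carrier.domRestrict X)) {Ω : Set ℂ}
    (hgraph : IsGraphOver (X '' M.carrier) Ω) {p₀ : R} (hp₀ : p₀ ∈ M.int)
    (hstar : StarConvex ℝ (proj₀ (X p₀)) Ω) {f : R → ℝ} (hfc : ContinuousOn f M.carrier)
    (hfh : HarmonicOnSurface f M.int) {C : ℝ} (hC : ∀ p ∈ M.carrier, f p ≤ C)
    (h0 : ∀ p ∈ M.boundary, f p = 0) {p : R} (hp : p ∈ M.carrier) : f p ≤ 0 := by
  obtain ⟨r₀, δ, hδ, hδr, hin, hest⟩ := exists_height_estimate hX hproper hgraph hp₀ hstar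
  set K : Set E3 := {x | ‖proj₀ x - proj₀ (X p₀)‖ ≤ r₀ ∧ |x 2 - X p₀ 2| ≤ r₀}
  have hKc : IsCompact K := by
    have hcl : IsClosed K := by
      have h2 : Continuous fun x : E3 => |x 2 - X p₀ 2| := by fun_prop
      exact (isClosed_le (continuous_proj₀.sub continuous_const).norm continuous_const).inter
        (isClosed_le h2 continuous_const)
    refine (isCompact_closedBall (X p₀) (2 * r₀)).of_isClosed_subset hcl fun x hx => ?_
    rw [mem_closedBall_iff_norm]
    have h3 : ‖x - X p₀‖ ^ 2 ≤ (2 * r₀) ^ 2 := by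
      rw [norm_sq_eq, proj₀_sub, PiLp.sub_apply, ← sq_abs (x 2 - X p₀ 2)]
      nlinarith [norm_nonneg (proj₀ x - proj₀ (X p₀)), abs_nonneg (x 2 - X p₀ 2), hx.1, hx.2]
    exact le_of_sq_le_sq h3 (by linarith)
  have hMK := isCompact_inter_preimage hproper hKc
  have hr₀ : 0 ≤ r₀ := hδ.le.trans hδr
  obtain ⟨q, hq, hqmax⟩ := hMK.exists_isMaxOn ⟨p₀, hp₀.1, by simpa [K] using hr₀⟩
    (hfc.mono inter_subset_left)
  have hle : ∀ q' ∈ M.carrier, f q' ≤ max (f q) 0 := fun q' hq' =>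
    le_of_le_on_compact hX hproper hδ hδr hest hfc hfh hC h0 (le_max_right _ _)
      (fun s hs hsr => le_max_of_le_left (hqmax ⟨hs, hsr, hin s hs hsr⟩)) hq'
  rcases le_or_gt (f q) 0 with hq0 | hq0
  · simpa [max_eq_right hq0] using hle p hp
  exfalso
  rw [max_eq_left hq0.le] at hle
  have hint : ∀ s ∈ M.carrier, f s = f q → s ∈ M.int := fun s hs hsq =>
    ⟨hs, fun hb => by linarith [h0 s hb]⟩
  set A : Set R := {s | s ∈ M.int ∧ f s = f q}
  have hAo : IsOpen A := by
    rw [isOpen_iff_mem_nhds]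
    rintro s ⟨hs, hsq⟩
    have hsM := M.isOpen_int.mem_nhds hs
    have hmax : IsLocalMax f s := by
      filter_upwards [hsM] with s' hs'
      rw [hsq]
      exact hle s' hs'.1
    filter_upwards [hsM, hfh.eventually_eq M.isOpen_int hs hmax] with s' h1 h2
    exact ⟨h1, h2.trans hsq⟩
  have hsub : M.carrier ⊆ A := by
    -- The level set `A` of a positive maximum is open by the strong maximum principle and
    -- relatively closed because boundary points have value zero.
    refine M.isConnected.isPreconnected.subset_of_closure_inter_subset hAo
      ⟨q, hq.1, hint q hq.1 rfl, rfl⟩ ?_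
    rintro s ⟨hsA, hsM⟩
    have hsq : f s ∈ closure {f q} := by
      refine ((hfc s hsM).mono (fun _ h => h.1.1 : A ⊆ M.carrier)).mem_closure hsA ?_
      exact fun a ha => ha.2
    rw [closure_singleton] at hsq
    exact ⟨hint s hsM hsq, hsq⟩
  obtain ⟨b, hb⟩ := hM
  exact (hsub (M.boundary_subset hb)).1.2 hb

end Parabolicity

end MaximalSurface

theorem mainTheorem2 {R : Type*} [TopologicalSpace R] [T2Space R] [ChartedSpace ℂ R]
    [IsManifold 𝓘(ℂ, ℂ) ω R]
    (M : MaximalSurface.BorderedSurface R) (hM : M.boundary.Nonempty)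
    (X : R → MaximalSurface.E3) (hX : MaximalSurface.IsConformalMaximalImmersion M X)
    (hproper : IsProperMap (M.carrier.domRestrict X))
    (Ω : Set ℂ) (hΩ : IsClosed Ω) (hgraph : MaximalSurface.IsGraphOver (X '' M.carrier) Ω)
    (p₀ : R) (hp₀ : p₀ ∈ M.int) (hstar : StarConvex ℝ (MaximalSurface.proj₀ (X p₀)) Ω) :
    M.RelativeParabolic := by
  rintro f hfc hfh ⟨C, hC⟩ h0 p hp
  have h1 := MaximalSurface.nonpos_of_starConvex hM hX hproper hgraph hp₀ hstar hfc hfh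
    (fun q hq => (abs_le.1 (hC q hq)).2) h0 hp
  have h2 := MaximalSurface.nonpos_of_starConvex hM hX hproper hgraph hp₀ hstar hfc.neg hfh.neg
    (C := C) (fun q hq => neg_le.1 (abs_le.1 (hC q hq)).1) (fun q hq => by simp [h0 q hq]) hp
  simp only [Pi.neg_apply] at h2
  linarith
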